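/- All oracle machines have finitely many states, a two-way infinite work tape that initially holds the input $x\in\{0,1\}^*$, and a two-way infinite, initially blank query tape. In designated query states, a step begins with an oracle call: with a word $w\in\{0,1\}^*$ directly to the left of the scanned cell of the query tape (the maximal block of bits there) and a bit $b$ in the scanned cell, a call to the oracle $B\subseteq\{0,1\}^*$ replaces $b$ by $b\oplus B(w)$, where $B(w)=1$ if $w\in B$ and $B(w)=0$ otherwise. Each state shows an output $1$, $0$ or "don't know". A probabilistic machine makes each transition according to a fair coin flip. A quantum machine has algebraic transition amplitudes and a time evolution that preserves the Euclidean norm of all finite superpositions of configurations. A machine runs for $p(|x|)$ steps, where $p$ is a polynomial with coefficients in $\mathbb N$, and its output is then observed; $P_b(x)$ denotes the probability of output $b\in\{0,1\}$. For an oracle $B\subseteq\{0,1\}^*$, let $\mathrm{ZPP}^B$ be the class of languages $L\subseteq\{0,1\}^*$ for which some probabilistic machine with oracle $B$ and some polynomial $p$ satisfy $P_1(x)\ge 1/2$, $P_0(x)=0$ for all $x\in L$, and $P_0(x)\ge 1/2$, $P_1(x)=0$ for all $x\notin L$. Let $\mathrm{ZQP}^B$ be the same class with quantum machines in place of probabilistic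 ones. Let $\mathrm{EQP}^B$ be the class of languages $L$ for which some quantum machine with oracle $B$ and some polynomial $p$ satisfy $P_1(x)=1$ for all $x\in L$ and $P_0(x)=1$ for all $x\notin L$, and let $\mathrm{NQP}^B$ be the class of languages $L$ for which some quantum machine with oracle $B$ and some polynomial $p$ satisfy $P_1(x)>0$ for all $x\in L$ and $P_1(x)=0$ for all $x\notin L$. For a set $S$ of languages put $\mathrm{EQP}^{S}=\bigcup_{B\in S}\mathrm{EQP}^B$ and $\mathrm{ZQP}^{S}=\bigcup_{B\in S}\mathrm{ZQP}^B$. **Theorem 2.** There exists an oracle $A\subseteq\{0,1\}^*$ such that $$\mathrm{EQP}^{\mathrm{ZPP}^A}\not\subseteq\mathrm{NQP}^A \qquad\text{and}\qquad \mathrm{ZQP}^{\mathrm{ZQP}^A}\not\subseteq\mathrm{ZQP}^A .$$ -/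

import Mathlib

namespace OracleMachines

noncomputable section

/-! ### Tapes -/

/-- Tape symbols: the blank, the two bits, and `s` further symbols. -/
inductive Sym (s : ℕ) : Type
  | blank
  | bit (b : Bool)
  | mark (i : Fin s)
  deriving DecidableEq, Fintype

instance (s : ℕ) : Zero (Sym s) := ⟨Sym.blank⟩

/-- Head moves. -/
inductive Move : Type
  | left
  | stay
  | right
  deriving DecidableEq

instance : Fintype Move := ⟨{.left, .stay, .right}, fun d => by cases d <;> decide⟩

/-- The displacement of a head move. -/
def Move.shift : Move → ℤ
  | .left => -1
  | .stay => 0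
  | .right => 1

/-- A two-way infinite tape, blank in all but finitely many cells, with the position of its head. -/
@[ext] structure Tape (s : ℕ) : Type where
  cells : ℤ →₀ Sym s
  head : ℤ

namespace Tape

variable {s : ℕ}

/-- The scanned symbol. -/
def read (t : Tape s) : Sym s := t.cells t.head

/-- Write `a` into the scanned cell, then move the head. -/
def act (t : Tape s) (a : Sym s) (d : Move) : Tape s :=
  ⟨t.cells.update t.head a, t.head + d.shift⟩

/-- The blank tape with head at cell `0`. -/
def empty : Tape s := ⟨0, 0⟩

/-- The tape with the word `x` in the cells `0, …, |x| - 1` and head at cell `0`. -/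
def ofWord (x : List Bool) : Tape s :=
  ⟨Finsupp.embDomain Nat.castEmbedding (x.map Sym.bit).toFinsupp, 0⟩

/-- The number of consecutive cells, going left from the cell next to the scanned one,
that hold a bit. -/
def queryLength (t : Tape s) : ℕ :=
  sInf {j : ℕ | ∀ b, t.cells (t.head - 1 - j) ≠ Sym.bit b}

/-- The query word: the maximal block of bits directly to the left of the scanned cell,
read from left to right. -/
def queryWord (t : Tape s) : List Bool :=
  List.ofFn fun i : Fin t.queryLength =>
    decide (t.cells (t.head - t.queryLength + (i : ℕ)) = Sym.bit true)

open Classical in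
/-- An oracle call: with the query word `w` directly to the left of the scanned cell and a bit `b`
in the scanned cell, `b` is replaced by `b ⊕ A(w)`, that is `|w, b⟩ ↦ |w, b ⊕ A(w)⟩`.
If the scanned cell holds no bit, then nothing happens. -/
def callOracle (A : Language Bool) (t : Tape s) : Tape s :=
  match t.read with
  | .bit b => ⟨t.cells.update t.head (Sym.bit (xor b (decide (t.queryWord ∈ A)))), t.head⟩
  | _ => t

end Tape

/-! ### Oracle machines with a work tape and a query tape -/

/-- What classical and quantum oracle machines have in common: the finite set of states,
the alphabet, the initial state, the query states, and the output shown by each state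
(`none` is "don't know"). -/
structure Frame : Type where
  numStates : ℕ
  numMarks : ℕ
  start : Fin numStates
  isQuery : Fin numStates → Bool
  output : Fin numStates → Option Bool

namespace Frame

variable (F : Frame)

abbrev State : Type := Fin F.numStates

abbrev Symbol : Type := Sym F.numMarks

/-- What a machine does in one step: new state, symbols written on the work tape and on the
query tape, moves of the two heads. -/
abbrev Action : Type := F.State × F.Symbol × F.Symbol × Move × Move

/-- Configurations: state, work tape, query tape. -/
@[ext] structure Cfg : Type where
  state : F.State
  work : Tape F.numMarks
  query : Tape F.numMarks

variable {F}

/-- The configuration that an action leads to. -/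
def Cfg.act (c : F.Cfg) : F.Action → F.Cfg
  | (q, a, b, d, e) => ⟨q, c.work.act a d, c.query.act b e⟩

/-- In a query state the oracle is applied to the query tape. -/
def Cfg.callOracle (A : Language Bool) (c : F.Cfg) : F.Cfg :=
  if F.isQuery c.state then { c with query := c.query.callOracle A } else c

variable (F)

/-- The initial configuration on input `x`. -/
def init (x : List Bool) : F.Cfg := ⟨F.start, Tape.ofWord x, Tape.empty⟩

end Frame

/-! ### Probabilistic machines -/

/-- A probabilistic oracle Turing machine: each step depends on a fair coin flip. -/
structure PTM extends Frame where
  δ : Bool → toFrame.State → toFrame.Symbol → toFrame.Symbol → toFrame.Action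

namespace PTM

variable (M : PTM)

/-- One step with oracle `A` and coin flip `r`: the oracle call, if the state is a query state,
followed by the transition. -/
def step (A : Language Bool) (c : M.Cfg) (r : Bool) : M.Cfg :=
  let c' := c.callOracle A
  c'.act (M.δ r c'.state c'.work.read c'.query.read)

/-- The probability, over `T` coin flips, that after `T` steps on input `x` the output is `b`. -/
def prob (A : Language Bool) (T : ℕ) (b : Bool) (x : List Bool) : ℝ :=
  ((Finset.univ.filter fun r : Fin T → Bool =>
    M.output ((List.ofFn r).foldl (M.step A) (M.init x)).state = some b).card : ℝ) / 2 ^ T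

end PTM

/-! ### Quantum machines -/

/-- Transition amplitudes for each state and pair of scanned symbols. -/
structure PreQTM extends Frame where
  δ : toFrame.State → toFrame.Symbol → toFrame.Symbol → toFrame.Action → ℂ

namespace PreQTM

variable (M : PreQTM)

/-- The superposition that the transition amplitudes assign to a configuration. -/
def succ (c : M.Cfg) : M.Cfg →₀ ℂ :=
  ∑ α : M.Action, Finsupp.single (c.act α) (M.δ c.state c.work.read c.query.read α)

/-- The time evolution operator without oracle, on finite superpositions of configurations. -/
def evolve : (M.Cfg →₀ ℂ) →ₗ[ℂ] (M.Cfg →₀ ℂ) :=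
  Finsupp.linearCombination ℂ M.succ

/-- One step with oracle `A`: the oracle call, on configurations in a query state,
followed by the transition. -/
def step (A : Language Bool) (ψ : M.Cfg →₀ ℂ) : M.Cfg →₀ ℂ :=
  M.evolve (ψ.mapDomain (Frame.Cfg.callOracle A))

/-- The superposition after `T` steps on input `x`. -/
def run (A : Language Bool) (T : ℕ) (x : List Bool) : M.Cfg →₀ ℂ :=
  (M.step A)^[T] (Finsupp.single (M.init x) 1)

/-- The squared Euclidean norm of a superposition. -/
def normSq (ψ : M.Cfg →₀ ℂ) : ℝ := ψ.sum fun _ z => ‖z‖ ^ 2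

/-- The probability that a measurement after `T` steps on input `x` gives output `b`. -/
def prob (A : Language Bool) (T : ℕ) (b : Bool) (x : List Bool) : ℝ :=
  (M.run A T x).sum fun c z => if M.output c.state = some b then ‖z‖ ^ 2 else 0

end PreQTM

/-- A quantum oracle Turing machine: the amplitudes are algebraic numbers, and the time evolution
preserves the Euclidean norm of every superposition of configurations. -/
structure QTM extends PreQTM where
  algebraic : ∀ q a b α, IsAlgebraic ℚ (δ q a b α)
  isometric : ∀ ψ, toPreQTM.normSq (toPreQTM.evolve ψ) = toPreQTM.normSq ψ

/-! ### Modes of computation; `P b x` is the probability of output `b` on input `x` -/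

/-- The output is correct with certainty. -/
def IsExact (P : Bool → List Bool → ℝ) (L : Language Bool) : Prop :=
  ∀ x, (x ∈ L → P true x = 1) ∧ (x ∉ L → P false x = 1)

/-- The output is never wrong, and correct with probability at least `1 / 2`. -/
def IsZeroError (P : Bool → List Bool → ℝ) (L : Language Bool) : Prop :=
  ∀ x, (x ∈ L → 1 / 2 ≤ P true x ∧ P false x = 0) ∧
    (x ∉ L → 1 / 2 ≤ P false x ∧ P true x = 0)

/-- The acceptance probability is positive exactly on the members of the language. -/
def IsNondeterministic (P : Bool → List Bool → ℝ) (L : Language Bool) : Prop :=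
  ∀ x, (x ∈ L → 0 < P true x) ∧ (x ∉ L → P true x = 0)

/-! ### Complexity classes relative to an oracle; time bounds are polynomials in `|x|` -/

def ZPP (A : Language Bool) : Set (Language Bool) :=
  {L | ∃ (M : PTM) (p : Polynomial ℕ),
    IsZeroError (fun b x => M.prob A (p.eval x.length) b x) L}

def EQP (A : Language Bool) : Set (Language Bool) :=
  {L | ∃ (M : QTM) (p : Polynomial ℕ),
    IsExact (fun b x => M.prob A (p.eval x.length) b x) L}

def ZQP (A : Language Bool) : Set (Language Bool) :=
  {L | ∃ (M : QTM) (p : Polynomial ℕ),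
    IsZeroError (fun b x => M.prob A (p.eval x.length) b x) L}

def NQP (A : Language Bool) : Set (Language Bool) :=
  {L | ∃ (M : QTM) (p : Polynomial ℕ),
    IsNondeterministic (fun b x => M.prob A (p.eval x.length) b x) L}

/-- The class `C^S`, the union of the classes `C^B` over the oracles `B` in `S`. -/
def relativize (C : Language Bool → Set (Language Bool)) (S : Set (Language Bool)) :
    Set (Language Bool) :=
  ⋃ B ∈ S, C B

end

end OracleMachines

namespace OracleMachines

noncomputable section

/-! The oracle hides a Boolean function, and the separating language `constantLanguage A` records
the lengths at which it is constant. A word `w` of length n owns the block of oracle words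
`interleave w j` and `interleave w j ++ [false]` with `j` of length n. The value 0 is encoded by
having at least half of the first kind and none of the second in the oracle, the value 1 by the
reverse.

Upper bound: a random `j` reveals the value with probability at least 1/2 and never a wrong one, so
`decoded A` lies in ZPP^A (`decoded_mem_ZPP`). The same machine with Hadamard gates as coins puts it
in ZQP^A (`decoded_mem_ZQP`), because coins tossed into fresh cells never interfere. If the decoded
function is constant or balanced at every length, the Deutsch–Jozsa algorithm decides which,
exactly, with oracle `decoded A` (`constantAt_mem_EQP`).

Lower bound: after T steps every amplitude is a polynomial of degree at most T in the membership
bits of the oracle (`run_mem_lowDegree`). If a machine rejects all balanced encodings with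
certainty, its accepting amplitudes vanish on all of them. The slack in "at least half" makes a
balanced encoding survive the removal of few words, so such an amplitude vanishes near a corner of a
cube of oracles, hence on the whole cube by low degree. Applying this again to a second cube reaches
an encoding of the constant 0 (`eq_zero_of_eq_zero_on_balanced`), which the machine therefore
rejects as well. So each machine can be defeated by changing one high level of the oracle
(`exists_fails`).

Algebraic amplitudes leave only countably many machines, and a failure depends on finitely many
oracle words (`Fails.eventually`). A category argument (`exists_generic`) yields one oracle that
defeats all of them. Since EQP ⊆ ZQP ⊆ NQP relative to any oracle, one language gives both
separations. -/

/-! ### Weighted norms of finite superpositions -/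

/-- The squared norm of a superposition in which the basis vector `c` has weight `g c`. -/
def weight {X : Type*} (g : X → ℝ) (ψ : X →₀ ℂ) : ℝ := ψ.sum fun c z => g c * ‖z‖ ^ 2

section Weight

variable {X Y : Type*}

theorem weight_eq_sum (g : X → ℝ) (ψ : X →₀ ℂ) (S : Finset X) (h : ψ.support ⊆ S) :
    weight g ψ = ∑ c ∈ S, g c * ‖ψ c‖ ^ 2 :=
  Finsupp.sum_of_support_subset _ h _ (by simp)

theorem weight_mapDomain {f : X → Y} (hf : Function.Injective f) (g : Y → ℝ) (ψ : X →₀ ℂ) :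
    weight g (ψ.mapDomain f) = weight (g ∘ f) ψ :=
  Finsupp.sum_mapDomain_index_inj hf

theorem weight_congr {g g' : X → ℝ} {ψ : X →₀ ℂ} (h : ∀ c ∈ ψ.support, g c = g' c) :
    weight g ψ = weight g' ψ :=
  Finsupp.sum_congr fun c hc => by rw [h c hc]

theorem weight_mono {g g' : X → ℝ} (ψ : X →₀ ℂ) (h : ∀ c, g c ≤ g' c) :
    weight g ψ ≤ weight g' ψ :=
  Finset.sum_le_sum fun c _ => mul_le_mul_of_nonneg_right (h c) (by positivity)

theorem weight_nonneg {g : X → ℝ} (ψ : X →₀ ℂ) (h : ∀ c, 0 ≤ g c) : 0 ≤ weight g ψ :=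
  Finset.sum_nonneg fun c _ => mul_nonneg (h c) (by positivity)

theorem weight_add (g g' : X → ℝ) (ψ : X →₀ ℂ) :
    weight (g + g') ψ = weight g ψ + weight g' ψ := by
  simp only [weight, Finsupp.sum, ← Finset.sum_add_distrib, Pi.add_apply, add_mul]

/-- Used to drop the components on which the output is not the observed one; nothing needs to be
known about their amplitudes. -/
theorem weight_add_of_eq_zero (g : X → ℝ) (η φ : X →₀ ℂ)
    (h : ∀ c, φ c ≠ 0 → g c = 0) : weight g (η + φ) = weight g η := by
  classical
  rw [weight_eq_sum g (η + φ) (η.support ∪ φ.support) Finsupp.support_add,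
    weight_eq_sum g η (η.support ∪ φ.support) Finset.subset_union_left]
  refine Finset.sum_congr rfl fun c _ => ?_
  by_cases hc : φ c = 0
  · simp [hc]
  · simp [h c hc]

@[simp] theorem weight_single (g : X → ℝ) (c : X) (z : ℂ) :
    weight g (Finsupp.single c z) = g c * ‖z‖ ^ 2 := by
  simp [weight]

end Weight

/-! ### Hadamard transforms controlled by a flag -/

section Mix

variable {X : Type*} (flag one : X → Bool) (σ : X → X)

/-- The Hadamard transform on the flagged pairs `{x, σ x}`, where `one` distinguishes the second
basis vector from the first, and the identity on the other basis vectors. -/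
def mixBasis (x : X) : X →₀ ℂ :=
  if flag x then
    Finsupp.single x (((√2 : ℝ) : ℂ)⁻¹ * if one x then -1 else 1) +
      Finsupp.single (σ x) ((√2 : ℝ) : ℂ)⁻¹
  else Finsupp.single x 1

/-- The linear extension of `mixBasis`. -/
def mix : (X →₀ ℂ) →ₗ[ℂ] (X →₀ ℂ) := Finsupp.linearCombination ℂ (mixBasis flag one σ)

variable {flag one σ}

theorem mix_apply (hσ : Function.Involutive σ) (hflag : ∀ x, flag (σ x) = flag x)
    (ψ : X →₀ ℂ) (x : X) :
    mix flag one σ ψ x =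
      if flag x then ((√2 : ℝ) : ℂ)⁻¹ * ((if one x then -1 else 1) * ψ x + ψ (σ x)) else ψ x := by
  classical
  induction ψ using Finsupp.induction_linear with
  | zero => simp
  | add φ ψ h1 h2 => rw [map_add, Finsupp.add_apply, h1, h2]; split_ifs <;> simp <;> ring
  | single y z =>
    have e : (σ y = x) ↔ (y = σ x) := ⟨fun h => by rw [← h, hσ], fun h => by rw [h, hσ]⟩
    simp only [mix, Finsupp.linearCombination_single, mixBasis]
    by_cases hy : flag y
    · simp only [hy, if_true, Finsupp.smul_apply, Finsupp.add_apply, Finsupp.single_apply, e]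
      by_cases h1 : y = x
      · subst h1
        rw [if_pos hy]
        simp only [if_true, smul_eq_mul]
        split_ifs <;> ring
      · by_cases h2 : y = σ x
        · have : flag x := by rw [← hflag, ← h2]; exact hy
          simp [this, h2]
          ring_nf
          simp [← h2, h1]
        · simp [h1, h2]
    · simp only [hy, Finsupp.smul_apply, Finsupp.single_apply]
      by_cases h1 : y = x
      · subst h1; simp [hy]
      · by_cases h2 : y = σ x
        · have : ¬ flag x := by rw [← hflag, ← h2]; exact hy
          simp [this, h1]
        · simp [h1, h2]

theorem sum_eq_of_pairing (hσ : Function.Involutive σ)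
    {S : Finset X} (hS : ∀ x ∈ S, σ x ∈ S) {F G : X → ℝ}
    (h : ∀ x, F x + F (σ x) = G x + G (σ x)) : ∑ x ∈ S, F x = ∑ x ∈ S, G x := by
  -- Summing the pairwise identity over the `σ`-invariant set counts both sides twice.
  have key : ∀ F : X → ℝ, ∑ x ∈ S, F (σ x) = ∑ x ∈ S, F x := fun F =>
    Finset.sum_nbij' σ σ hS hS (fun x _ => hσ x) (fun x _ => hσ x) (fun _ _ => rfl)
  have h1 := Finset.sum_congr (s₁ := S) rfl fun x _ => h x
  rw [Finset.sum_add_distrib, Finset.sum_add_distrib, key, key] at h1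
  linarith

theorem weight_mix_eq (hσ : Function.Involutive σ) (hflag : ∀ x, flag (σ x) = flag x)
    {g g' : X → ℝ} {ψ : X →₀ ℂ}
    (h : ∀ x, g x * ‖mix flag one σ ψ x‖ ^ 2 + g (σ x) * ‖mix flag one σ ψ (σ x)‖ ^ 2 =
      g' x * ‖ψ x‖ ^ 2 + g' (σ x) * ‖ψ (σ x)‖ ^ 2) :
    weight g (mix flag one σ ψ) = weight g' ψ := by
  classical
  set S := ψ.support ∪ ψ.support.image σ
  have hS : ∀ x ∈ S, σ x ∈ S := by
    intro x hx
    rcases Finset.mem_union.1 hx with hx | hx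
    · exact Finset.mem_union_right _ (Finset.mem_image_of_mem _ hx)
    · obtain ⟨y, hy, rfl⟩ := Finset.mem_image.1 hx
      rw [hσ]; exact Finset.mem_union_left _ hy
  rw [weight_eq_sum _ _ S, weight_eq_sum _ _ S Finset.subset_union_left]
  · exact sum_eq_of_pairing hσ hS h
  · intro x hx
    by_contra hn
    rw [Finsupp.mem_support_iff, mix_apply hσ hflag] at hx
    have h1 : ψ x = 0 := by
      by_contra h0; exact hn (Finset.mem_union_left _ (Finsupp.mem_support_iff.2 h0))
    have h2 : ψ (σ x) = 0 := by
      by_contra h0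
      exact hn (by simpa [hσ x] using hS _ (Finset.mem_union_left _ (Finsupp.mem_support_iff.2 h0)))
    simp [h1, h2] at hx

theorem norm_sq_inv_sqrt_two_mul (z : ℂ) : ‖((√2 : ℝ) : ℂ)⁻¹ * z‖ ^ 2 = ‖z‖ ^ 2 / 2 := by
  rw [norm_mul, mul_pow, norm_inv, Complex.norm_real, inv_pow, Real.norm_eq_abs, sq_abs,
    Real.sq_sqrt (by norm_num)]
  ring

/-- Unitarity of the Hadamard transform, pair by pair: this is the parallelogram law. -/
theorem weight_mix_one (hσ : Function.Involutive σ) (hflag : ∀ x, flag (σ x) = flag x)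
    (hone : ∀ x, one (σ x) = !one x)
    (ψ : X →₀ ℂ) :
    weight (fun _ => 1) (mix flag one σ ψ) = weight (fun _ => 1) ψ := by
  refine weight_mix_eq hσ hflag fun x => ?_
  rw [mix_apply hσ hflag, mix_apply hσ hflag, hflag, hσ, hone]
  by_cases hx : flag x
  · simp only [hx, if_true, norm_sq_inv_sqrt_two_mul]
    have := parallelogram_law_with_norm ℝ (ψ x) (ψ (σ x))
    have e := norm_sub_rev (ψ (σ x)) (ψ x)
    have e' := norm_sub_rev (ψ x) (ψ (σ x))
    by_cases h1 : one x
    · simp only [h1, if_true, Bool.not_true, Bool.false_eq_true, if_false, neg_one_mul, one_mul,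
        neg_add_eq_sub]
      rw [e, add_comm (ψ (σ x))]; linarith
    · simp only [h1, Bool.not_false, Bool.false_eq_true, if_true, if_false, neg_one_mul, one_mul,
        neg_add_eq_sub]
      linarith
  · simp [hx]

/-- Absence of interference: if each flagged pair carries amplitude on its first member only, that
amplitude is split evenly, so the squared norms behave like probabilities under a fair coin. -/
theorem weight_mix_of_one_eq_false (hσ : Function.Involutive σ) (hflag : ∀ x, flag (σ x) = flag x)
    (hone : ∀ x, one (σ x) = !one x)
    (g : X → ℝ) (ψ : X →₀ ℂ)
    (h : ∀ x ∈ ψ.support, flag x → one x = false) :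
    weight g (mix flag one σ ψ) =
      weight (fun x => if flag x then (g x + g (σ x)) / 2 else g x) ψ := by
  refine weight_mix_eq hσ hflag fun x => ?_
  rw [mix_apply hσ hflag, mix_apply hσ hflag, hflag, hσ, hone]
  by_cases hx : flag x
  · simp only [hx, if_true, norm_sq_inv_sqrt_two_mul]
    have key : ∀ y, flag y → one y = true → ψ y = 0 := fun y hy h1 => by
      by_contra h0
      have := h y (Finsupp.mem_support_iff.2 h0) hy
      simp_all
    by_cases h1 : one x
    · have := key x hx h1
      simp only [h1, this]; simp; ring
    · have := key (σ x) (by rw [hflag]; exact hx) (by simp [hone, h1])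
      simp only [h1, this]; simp; ring
  · simp [hx]

end Mix

/-! ### Oracle calls are reversible -/

namespace Tape

variable {s : ℕ}

theorem queryLength_congr {t t' : Tape s} (hh : t'.head = t.head)
    (hc : ∀ i < t.head, t'.cells i = t.cells i) : t'.queryLength = t.queryLength := by
  unfold queryLength
  congr 1
  ext j
  simp only [Set.mem_ofPred_eq, hh]
  rw [hc _ (by omega)]

theorem queryWord_congr {t t' : Tape s} (hh : t'.head = t.head)
    (hc : ∀ i < t.head, t'.cells i = t.cells i) : t'.queryWord = t.queryWord := by
  have hl := queryLength_congr hh hc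
  unfold queryWord
  refine List.ext_getElem (by simp [hl]) fun i h1 h2 => ?_
  simp only [List.length_ofFn] at h2
  simp only [List.getElem_ofFn, hl, hh]
  rw [hc _ (by simp; omega)]
  rfl

/-- A call changes the scanned cell only, whereas the query word lies strictly to its left. The
second call therefore sees the same word and cancels the first. -/
theorem callOracle_involutive (A : Language Bool) :
    Function.Involutive (callOracle (s := s) A) := by
  intro t
  unfold callOracle
  cases h : t.read with
  | blank => simp [h]
  | mark i => simp [h]
  | bit b =>
    classical
    have hr : (⟨t.cells.update t.head (Sym.bit (xor b (decide (t.queryWord ∈ A)))), t.head⟩ :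
        Tape s).queryWord = t.queryWord :=
      queryWord_congr rfl fun i hi => by simp [Finsupp.update_apply, hi.ne]
    simp only [read, Finsupp.update_apply, if_true]
    ext i
    · simp only [Finsupp.update_apply]
      split_ifs with hi
      · subst hi
        rw [show t.cells t.head = Sym.bit b from h]
        convert (congrArg (fun w => Sym.bit (xor (xor b (decide (t.queryWord ∈ A)))
          (decide (w ∈ A)))) hr) using 2
        simp
      · rfl
    · rfl

end Tape

theorem Frame.Cfg.callOracle_state {F : Frame} (A : Language Bool) (c : F.Cfg) :
    (c.callOracle A).state = c.state := by
  unfold Frame.Cfg.callOracle; split_ifs <;> rfl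

theorem Frame.Cfg.callOracle_work {F : Frame} (A : Language Bool) (c : F.Cfg) :
    (c.callOracle A).work = c.work := by
  unfold Frame.Cfg.callOracle; split_ifs <;> rfl

theorem Frame.Cfg.callOracle_involutive {F : Frame} (A : Language Bool) :
    Function.Involutive (Frame.Cfg.callOracle (F := F) A) := by
  intro c
  unfold Frame.Cfg.callOracle
  by_cases h : F.isQuery c.state
  · simp only [h, if_true, Tape.callOracle_involutive A c.query]
  · simp [h]

theorem Frame.Cfg.callOracle_of_not_isQuery {F : Frame} (A : Language Bool) {c : F.Cfg}
    (h : F.isQuery c.state = false) : c.callOracle A = c := by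
  simp [Frame.Cfg.callOracle, h]

/-! ### Quantum machines: linearity and norms -/

namespace PreQTM

variable (M : PreQTM)

/-- One step as a linear map. -/
def stepLinear (A : Language Bool) : (M.Cfg →₀ ℂ) →ₗ[ℂ] (M.Cfg →₀ ℂ) :=
  M.evolve ∘ₗ Finsupp.lmapDomain ℂ ℂ (Frame.Cfg.callOracle A)

theorem stepLinear_apply (A : Language Bool) (ψ : M.Cfg →₀ ℂ) :
    M.stepLinear A ψ = M.step A ψ := rfl

theorem stepLinear_single (A : Language Bool) (c : M.Cfg) :
    M.stepLinear A (Finsupp.single c 1) = M.succ (c.callOracle A) := by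
  simp [stepLinear, evolve]

theorem run_succ (A : Language Bool) (T : ℕ) (x : List Bool) :
    M.run A (T + 1) x = M.step A (M.run A T x) :=
  Function.iterate_succ_apply' _ _ _

theorem normSq_eq_weight (ψ : M.Cfg →₀ ℂ) : M.normSq ψ = weight (fun _ => 1) ψ := by
  simp [normSq, weight]

theorem prob_eq_weight (A : Language Bool) (T : ℕ) (b : Bool) (x : List Bool) :
    M.prob A T b x =
      weight (fun c => if M.output c.state = some b then 1 else 0) (M.run A T x) := by
  simp [prob, weight]

end PreQTM

namespace QTM

variable (M : QTM)

theorem normSq_step (A : Language Bool) (ψ : M.Cfg →₀ ℂ) :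
    M.normSq (M.step A ψ) = M.normSq ψ := by
  rw [PreQTM.step, M.isometric, PreQTM.normSq_eq_weight, PreQTM.normSq_eq_weight,
    weight_mapDomain (Frame.Cfg.callOracle_involutive A).injective]
  rfl

theorem normSq_run (A : Language Bool) (T : ℕ) (x : List Bool) :
    M.normSq (M.run A T x) = 1 := by
  induction T with
  | zero => simp [PreQTM.run, PreQTM.normSq_eq_weight]
  | succ T ih => rw [PreQTM.run_succ, normSq_step, ih]

theorem prob_nonneg (A : Language Bool) (T : ℕ) (b : Bool) (x : List Bool) :
    0 ≤ M.prob A T b x := by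
  rw [PreQTM.prob_eq_weight]
  exact weight_nonneg _ fun c => by split_ifs <;> norm_num

theorem prob_add_prob_le (A : Language Bool) (T : ℕ) (x : List Bool) :
    M.prob A T true x + M.prob A T false x ≤ 1 := by
  rw [PreQTM.prob_eq_weight, PreQTM.prob_eq_weight, ← weight_add]
  refine (weight_mono (g' := fun _ => 1) _ fun c => ?_).trans_eq
    ((M.normSq_eq_weight _).symm.trans (M.normSq_run A T x))
  simp only [Pi.add_apply]
  split_ifs with h1 h2 <;> simp_all

theorem prob_add_prob_eq (A : Language Bool) (T : ℕ) (x : List Bool)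
    (h : ∀ q, M.output q ≠ none) : M.prob A T true x + M.prob A T false x = 1 := by
  rw [PreQTM.prob_eq_weight, PreQTM.prob_eq_weight, ← weight_add]
  refine (weight_congr (g' := fun _ => 1) fun c _ => ?_).trans
    ((M.normSq_eq_weight _).symm.trans (M.normSq_run A T x))
  have := h c.state
  rcases e : M.output c.state with _ | _ | _
  · exact absurd e this
  · simp [e]
  · simp [e]

end QTM

theorem EQP_subset_ZQP (A : Language Bool) : EQP A ⊆ ZQP A := by
  rintro L ⟨M, p, h⟩
  refine ⟨M, p, fun x => ⟨fun hx => ?_, fun hx => ?_⟩⟩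
  · have h1 := (h x).1 hx
    have h2 := M.prob_add_prob_le A (p.eval x.length) x
    have h3 := M.prob_nonneg A (p.eval x.length) false x
    simp only at h1 ⊢
    constructor <;> linarith
  · have h1 := (h x).2 hx
    have h2 := M.prob_add_prob_le A (p.eval x.length) x
    have h3 := M.prob_nonneg A (p.eval x.length) true x
    simp only at h1 ⊢
    constructor <;> linarith

theorem ZQP_subset_NQP (A : Language Bool) : ZQP A ⊆ NQP A := by
  rintro L ⟨M, p, h⟩
  exact ⟨M, p, fun x => ⟨fun hx => by linarith [((h x).1 hx).1], fun hx => ((h x).2 hx).2⟩⟩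

/-! ### Probabilistic machines: a recursion for the output probability -/

namespace PTM

variable (M : PTM)

/-- The probability that the output is `b` after `t` more steps. -/
def outputProb (A : Language Bool) (b : Bool) : ℕ → M.Cfg → ℝ
  | 0, c => if M.output c.state = some b then 1 else 0
  | t + 1, c => (outputProb A b t (M.step A c false) + outputProb A b t (M.step A c true)) / 2

/-- Conditioning on the first coin turns the count over coin sequences into the backward recursion.
-/
theorem sum_coins_eq_outputProb (A : Language Bool) (b : Bool) (T : ℕ) (c : M.Cfg) :
    (∑ r : Fin T → Bool,
      if M.output ((List.ofFn r).foldl (M.step A) c).state = some b then (1 : ℝ) else 0) =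
      2 ^ T * M.outputProb A b T c := by
  induction T generalizing c with
  | zero => simp [outputProb]
  | succ T ih =>
    rw [← Fintype.sum_equiv (Fin.consEquiv fun _ : Fin (T + 1) => Bool)
      (fun p : Bool × (Fin T → Bool) =>
        if M.output ((List.ofFn p.2).foldl (M.step A) (M.step A c p.1)).state = some b
        then (1 : ℝ) else 0) _ (fun p => by simp [Fin.consEquiv, List.ofFn_succ])]
    rw [Fintype.sum_prod_type, Fintype.sum_bool]
    dsimp only
    rw [ih, ih, outputProb]
    ring

theorem prob_eq_outputProb (A : Language Bool) (T : ℕ) (b : Bool) (x : List Bool) :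
    M.prob A T b x = M.outputProb A b T (M.init x) := by
  have := M.sum_coins_eq_outputProb A b T (M.init x)
  rw [prob, Finset.card_filter]
  push_cast
  rw [this]
  field_simp

end PTM

/-! ### Reversible machines with coin states -/

/-- The involution that exchanges the blank with the mark, and the two bits. -/
def Sym.toggle : Sym 1 → Sym 1
  | .blank => .mark 0
  | .bit b => .bit !b
  | .mark _ => .blank

/-- The second members of the pairs that `Sym.toggle` exchanges. -/
def Sym.isOne : Sym 1 → Bool
  | .blank => false
  | .bit b => b
  | .mark _ => true

theorem Sym.toggle_involutive : Function.Involutive Sym.toggle := by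
  rintro (_ | b | i)
  · rfl
  · simp [Sym.toggle]
  · simp [Sym.toggle]; omega

theorem Sym.isOne_toggle (a : Sym 1) : a.toggle.isOne = !a.isOne := by
  cases a <;> rfl

/-- A machine whose steps are reversible up to coin flips. The work tape is read only.
In a coin state, which may depend on the scanned symbol of the work tape, the scanned symbol of the
query tape is first randomized within its pair.
Then the state and the scanned symbol of the query tape are permuted, and the heads make the moves
that belong to the new state. -/
structure CoinMachine where
  numStates : ℕ
  start : Fin numStates
  isQuery : Fin numStates → Bool
  output : Fin numStates → Option Bool
  coin : Fin numStates → Sym 1 → Bool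
  dir : Fin numStates → Move × Move
  perm : Sym 1 → Equiv.Perm (Fin numStates × Sym 1)

namespace CoinMachine

variable (M : CoinMachine)

abbrev frame : Frame := ⟨M.numStates, 1, M.start, M.isQuery, M.output⟩

/-- The action taken in state `q` with scanned symbols `a` and `b`, after randomization. -/
def action (q : M.frame.State) (a b : Sym 1) : M.frame.Action :=
  ((M.perm a (q, b)).1, a, (M.perm a (q, b)).2, M.dir (M.perm a (q, b)).1)

/-- The machine that flips a fair coin in each coin state. -/
abbrev toPTM : PTM where
  toFrame := M.frame
  δ r q a b := M.action q a (if M.coin q a && r then b.toggle else b)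

/-- The machine that applies a Hadamard transform in each coin state. -/
abbrev toPreQTM : PreQTM where
  toFrame := M.frame
  δ q a b α :=
    if M.coin q a then
      (if α = M.action q a b then ((√2 : ℝ) : ℂ)⁻¹ * (if b.isOne then -1 else 1) else 0) +
        (if α = M.action q a b.toggle then ((√2 : ℝ) : ℂ)⁻¹ else 0)
    else if α = M.action q a b then 1 else 0

variable {M}

/-- The deterministic part of a step. -/
def advance (c : M.frame.Cfg) : M.frame.Cfg :=
  c.act (M.action c.state c.work.read c.query.read)

/-- Toggle the scanned symbol of the query tape. -/
def toggle (c : M.frame.Cfg) : M.frame.Cfg :=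
  { c with query := ⟨c.query.cells.update c.query.head c.query.read.toggle, c.query.head⟩ }

theorem read_toggle (c : M.frame.Cfg) : (toggle c).query.read = c.query.read.toggle := by
  classical
  simp [toggle, Tape.read, Finsupp.update_apply]

theorem toggle_involutive : Function.Involutive (toggle (M := M)) := by
  classical
  intro c
  have h := read_toggle c
  unfold toggle at h ⊢
  simp only [h, Sym.toggle_involutive c.query.read]
  ext i
  · rfl
  · rfl
  · rfl
  · simp only [Finsupp.update_apply]
    split_ifs with hi
    · rw [hi]; rfl
    · rfl
  · rfl

theorem advance_toggle (c : M.frame.Cfg) :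
    advance (toggle c) = c.act (M.action c.state c.work.read c.query.read.toggle) := by
  classical
  unfold advance
  rw [read_toggle]
  simp only [Frame.Cfg.act, toggle, Tape.act, Frame.Cfg.mk.injEq, Tape.mk.injEq, true_and, and_true,
    action]
  ext i
  simp only [Finsupp.update_apply]
  split_ifs <;> rfl

/-- The new state determines both head moves, so the old head positions can be recovered. The work
tape is unchanged, and inverting the permutation for its scanned symbol recovers the old state and
query symbol. -/
theorem advance_injective : Function.Injective (advance (M := M)) := by
  classical
  intro c c' h
  simp only [advance, action, Frame.Cfg.act, Tape.act, Frame.Cfg.mk.injEq, Tape.mk.injEq] at h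
  obtain ⟨hq, ⟨hw, hwh⟩, hc, hch⟩ := h
  rw [hq, add_left_inj] at hwh hch
  have ew : c.work = c'.work := by
    ext i
    · have := DFunLike.congr_fun hw i
      simp only [Finsupp.update_apply] at this
      rw [← hwh] at this
      split_ifs at this with hi
      · rw [hi]
        rwa [Tape.read, Tape.read, ← hwh] at this
      · exact this
    · exact hwh
  have ep := DFunLike.congr_fun hc c.query.head
  simp only [Finsupp.update_apply, if_true, ← hch] at ep
  rw [ew] at hq ep
  have hp := (M.perm c'.work.read).injective (Prod.ext hq ep)
  simp only [Prod.mk.injEq] at hp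
  have eq : c.query = c'.query := by
    ext i
    · have := DFunLike.congr_fun hc i
      simp only [Finsupp.update_apply] at this
      rw [← hch] at this
      split_ifs at this with hi
      · rw [hi]
        have := hp.2
        rwa [Tape.read, Tape.read, ← hch] at this
      · exact this
    · exact hch
  exact Frame.Cfg.ext hp.1 ew eq

/-- The Hadamard transform of the scanned symbol of the query tape in coin states. -/
abbrev mixCoin : (M.frame.Cfg →₀ ℂ) →ₗ[ℂ] (M.frame.Cfg →₀ ℂ) :=
  mix (fun c => M.coin c.state c.work.read) (fun c => c.query.read.isOne) toggle

theorem succ_eq (c : M.frame.Cfg) :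
    M.toPreQTM.succ c = (mixBasis (fun c : M.frame.Cfg => M.coin c.state c.work.read)
      (fun c => c.query.read.isOne) toggle c).mapDomain advance := by
  classical
  unfold PreQTM.succ mixBasis
  by_cases h : M.coin c.state c.work.read
  · simp only [h, if_true, Finsupp.mapDomain_add, Finsupp.mapDomain_single, advance_toggle,
      Finsupp.single_add, Finset.sum_add_distrib]
    congr 1
    · rw [Finset.sum_eq_single (M.action c.state c.work.read c.query.read)]
      · simp [advance]
      · intro α _ hα; simp [hα]
      · simp
    · rw [Finset.sum_eq_single (M.action c.state c.work.read c.query.read.toggle)]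
      · simp
      · intro α _ hα; simp [hα]
      · simp
  · simp only [h]
    rw [Finset.sum_eq_single (M.action c.state c.work.read c.query.read)]
    · simp [advance]
    · intro α _ hα; simp [hα]
    · simp

theorem evolve_eq (ψ : M.frame.Cfg →₀ ℂ) :
    M.toPreQTM.evolve ψ = (mixCoin ψ).mapDomain advance := by
  have : M.toPreQTM.evolve = Finsupp.lmapDomain ℂ ℂ advance ∘ₗ mixCoin := by
    refine Finsupp.lhom_ext' fun c => LinearMap.ext_ring ?_
    simp [PreQTM.evolve, succ_eq, mix]
  exact DFunLike.congr_fun this ψ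

theorem isAlgebraic_inv_sqrt_two : IsAlgebraic ℚ (((√2 : ℝ) : ℂ)⁻¹) := by
  refine IsAlgebraic.inv ?_
  refine IsAlgebraic.of_pow (n := 2) (by norm_num) ?_
  rw [← Complex.ofReal_pow, Real.sq_sqrt (by norm_num)]
  simpa using isAlgebraic_algebraMap (R := ℚ) (A := ℂ) 2

variable (M) in
/-- The quantum machine that applies a Hadamard transform in each coin state. -/
def toQTM : QTM where
  toPreQTM := M.toPreQTM
  algebraic q a b α := by
    have := isAlgebraic_inv_sqrt_two
    have h0 : IsAlgebraic ℚ (0 : ℂ) := isAlgebraic_zero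
    have h1 : IsAlgebraic ℚ (1 : ℂ) := isAlgebraic_one
    dsimp only
    split_ifs <;>
      first
      | exact h0 | exact h1
      | exact IsAlgebraic.add (by first | exact this.mul h1.neg | exact this.mul h1 | exact h0)
          (by first | exact this | exact h0)
  isometric ψ := by
    rw [PreQTM.normSq_eq_weight, PreQTM.normSq_eq_weight, evolve_eq,
      weight_mapDomain advance_injective]
    exact weight_mix_one toggle_involutive (fun _ => rfl)
      (fun c => by simp only [read_toggle, Sym.isOne_toggle]) ψ

/-- The randomization in a coin state acts, during the next `t` steps and for all coin flips,
on symbols that are the first in their pair. -/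
def Fresh (A : Language Bool) : ℕ → M.frame.Cfg → Prop
  | 0, _ => True
  | t + 1, c => (M.coin c.state c.work.read → (c.callOracle A).query.read.isOne = false) ∧
      ∀ r, Fresh A t (M.toPTM.step A c r)

theorem toPTM_step (A : Language Bool) (c : M.frame.Cfg) (r : Bool) :
    M.toPTM.step A c r = if M.coin c.state c.work.read && r then advance (toggle (c.callOracle A))
      else advance (c.callOracle A) := by
  unfold PTM.step
  dsimp only
  rw [advance_toggle, advance, Frame.Cfg.callOracle_state, Frame.Cfg.callOracle_work]
  split_ifs <;> rfl

/-- Oracle call and deterministic part are injective on configurations, so they merely relabel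
amplitudes. The Hadamard transform averages, because the coin symbols are first in their pairs. -/
theorem weight_step (A : Language Bool) (g : M.frame.Cfg → ℝ) (ψ : M.frame.Cfg →₀ ℂ)
    (h : ∀ c ∈ ψ.support, M.coin c.state c.work.read → (c.callOracle A).query.read.isOne = false) :
    weight g (M.toPreQTM.step A ψ) =
      weight (fun c => (g (M.toPTM.step A c false) + g (M.toPTM.step A c true)) / 2) ψ := by
  classical
  have hinj := (Frame.Cfg.callOracle_involutive (F := M.frame) A).injective
  rw [PreQTM.step, evolve_eq, weight_mapDomain advance_injective,
    weight_mix_of_one_eq_false toggle_involutive (fun _ => rfl)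
      (fun c => by simp only [read_toggle, Sym.isOne_toggle]), weight_mapDomain hinj]
  · refine weight_congr fun c _ => ?_
    simp only [Function.comp, toPTM_step, Frame.Cfg.callOracle_state, Frame.Cfg.callOracle_work]
    by_cases hc : M.coin c.state c.work.read <;> simp [hc]
  · intro c hc
    obtain ⟨c, hc', rfl⟩ := Finset.mem_image.1 (Finsupp.mapDomain_support hc)
    rw [Frame.Cfg.callOracle_state, Frame.Cfg.callOracle_work]
    exact h c hc'

theorem weight_iterate_step (A : Language Bool) (b : Bool) (T : ℕ) (ψ : M.frame.Cfg →₀ ℂ)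
    (h : ∀ c ∈ ψ.support, Fresh A T c) :
    weight (M.toPTM.outputProb A b 0) ((M.toPreQTM.step A)^[T] ψ) =
      weight (M.toPTM.outputProb A b T) ψ := by
  classical
  induction T generalizing ψ with
  | zero => rfl
  | succ T ih =>
    rw [Function.iterate_succ_apply, ih, weight_step A _ ψ fun c hc => (h c hc).1]
    · rfl
    · intro c hc
      rw [PreQTM.step, evolve_eq] at hc
      obtain ⟨d, hd, rfl⟩ := Finset.mem_image.1 (Finsupp.mapDomain_support hc)
      rw [Finsupp.mem_support_iff, mix_apply toggle_involutive (fun _ => rfl)] at hd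
      have hstep : ∀ e, ψ.mapDomain (Frame.Cfg.callOracle A) e ≠ 0 →
          ∃ c ∈ ψ.support, c.callOracle A = e := fun e he => by
        simpa using Finset.mem_image.1 (Finsupp.mapDomain_support (Finsupp.mem_support_iff.2 he))
      -- A configuration in the support comes either from `d` itself (coin `false`) or from its
      -- partner `toggle d` (coin `true`). Either way it is a classical successor, so freshness is
      -- inherited.
      by_cases h1 : ψ.mapDomain (Frame.Cfg.callOracle A) d = 0
      · by_cases hcoin : M.coin d.state d.work.read
        · by_cases h2 : ψ.mapDomain (Frame.Cfg.callOracle A) (toggle d) = 0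
          · simp [h1, h2] at hd
          · obtain ⟨c, hc, hcd⟩ := hstep _ h2
            have := (h c hc).2 true
            rw [toPTM_step, hcd, toggle_involutive,
              show M.coin c.state c.work.read = true by
                rw [← Frame.Cfg.callOracle_state A c, ← Frame.Cfg.callOracle_work A c, hcd]
                exact hcoin] at this
            exact this
        · simp [hcoin, h1] at hd
      · obtain ⟨c, hc, hcd⟩ := hstep _ h1
        have := (h c hc).2 false
        rw [toPTM_step, hcd] at this
        simpa using this

theorem toQTM_prob_eq (A : Language Bool) (T : ℕ) (b : Bool) (x : List Bool)
    (h : Fresh A T (M.frame.init x)) : M.toQTM.prob A T b x = M.toPTM.prob A T b x := by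
  rw [PTM.prob_eq_outputProb, PreQTM.prob_eq_weight]
  refine (weight_iterate_step A b T (Finsupp.single (M.frame.init x) 1) ?_).trans (by simp)
  intro c hc
  rw [Finset.mem_singleton.1 (Finsupp.support_single_subset hc)]
  exact h

end CoinMachine

/-- A partial injection of a finite type extends to a permutation. -/
theorem exists_perm_extending {α : Type*} [Fintype α] [DecidableEq α] (f : α → Option α)
    (hf : ∀ x y, (f x).isSome → f x = f y → x = y) :
    ∃ π : Equiv.Perm α, ∀ x y, f x = some y → π x = y := by
  -- The default in `getD x` is irrelevant: agreement is only asked for on the domain of `f`.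
  obtain ⟨g, hg⟩ := Finset.exists_equiv_extend_of_card_eq (α := α) (t := Finset.univ)
    (by simp) (s := Finset.univ.filter fun x => (f x).isSome) (f := fun x => (f x).getD x)
    (by simp) (by
      intro x hx y hy hxy
      simp only [Finset.coe_filter, Finset.mem_univ, true_and, Set.mem_ofPred_eq,
        Option.isSome_iff_exists] at hx hy
      obtain ⟨a, ha⟩ := hx
      obtain ⟨b, hb⟩ := hy
      simp only [ha, hb, Option.getD_some] at hxy
      exact hf x y (by simp [ha]) (by rw [ha, hb, hxy]))
  refine ⟨g.trans (Equiv.subtypeUnivEquiv Finset.mem_univ), fun x y hxy => ?_⟩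
  have := hg x (by simp [hxy])
  simpa [hxy] using this

/-! ### Single steps of coin machines on basis configurations. -/

namespace CoinMachine

variable {M : CoinMachine}

/-- Go to state `q`, write `b` on the query tape and move the heads as state `q` demands. -/
def moveTo (c : M.frame.Cfg) (q : Fin M.numStates) (b : Sym 1) : M.frame.Cfg :=
  ⟨q, ⟨c.work.cells, c.work.head + (M.dir q).1.shift⟩,
    ⟨c.query.cells.update c.query.head b, c.query.head + (M.dir q).2.shift⟩⟩

theorem advance_eq {c : M.frame.Cfg} {q : Fin M.numStates} {b : Sym 1}
    (h : M.perm c.work.read (c.state, c.query.read) = (q, b)) :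
    advance c = moveTo c q b := by
  classical
  simp only [advance, action, moveTo, h, Frame.Cfg.act, Tape.act, Frame.Cfg.mk.injEq, Tape.mk.injEq,
    true_and, and_true]
  ext i
  simp +contextual [Tape.read]

theorem advance_toggle_eq {c : M.frame.Cfg} {q : Fin M.numStates} {b : Sym 1}
    (h : M.perm c.work.read (c.state, c.query.read.toggle) = (q, b)) :
    advance (toggle c) = moveTo c q b := by
  classical
  rw [advance_eq (q := q) (b := b) (by rw [read_toggle]; exact h)]
  simp only [toggle, moveTo, Frame.Cfg.mk.injEq, Tape.mk.injEq, true_and, and_true]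
  ext i
  simp only [Finsupp.update_apply]
  split_ifs <;> rfl

theorem toPTM_step_eq {A : Language Bool} {c c' : M.frame.Cfg} (hc : c.callOracle A = c')
    {r : Bool} {q : Fin M.numStates} {b : Sym 1}
    (h : M.perm c'.work.read
      (c'.state,
        if M.coin c'.state c'.work.read && r then c'.query.read.toggle else c'.query.read) = (q, b)) :
    M.toPTM.step A c r = moveTo c' q b := by
  rw [toPTM_step, ← Frame.Cfg.callOracle_state A c, ← Frame.Cfg.callOracle_work A c, hc]
  split_ifs at h ⊢ with hr
  · exact advance_toggle_eq h
  · exact advance_eq h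

theorem stepLinear_single_eq {A : Language Bool} {c c' : M.frame.Cfg}
    (hc : c.callOracle A = c') (hcoin : M.coin c'.state c'.work.read = false)
    {q : Fin M.numStates} {b : Sym 1}
    (h : M.perm c'.work.read (c'.state, c'.query.read) = (q, b)) :
    M.toPreQTM.stepLinear A (Finsupp.single c 1) = Finsupp.single (moveTo c' q b) 1 := by
  rw [PreQTM.stepLinear_single]
  erw [hc, succ_eq]
  simp [mixBasis, hcoin, Finsupp.mapDomain_single, advance_eq h]

theorem stepLinear_single_coin {A : Language Bool} {c c' : M.frame.Cfg}
    (hc : c.callOracle A = c') (hcoin : M.coin c'.state c'.work.read = true)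
    {q₁ q₂ : Fin M.numStates} {b₁ b₂ : Sym 1}
    (h₁ : M.perm c'.work.read (c'.state, c'.query.read) = (q₁, b₁))
    (h₂ : M.perm c'.work.read (c'.state, c'.query.read.toggle) = (q₂, b₂)) :
    M.toPreQTM.stepLinear A (Finsupp.single c 1) =
      Finsupp.single (moveTo c' q₁ b₁)
        (((√2 : ℝ) : ℂ)⁻¹ * if c'.query.read.isOne then -1 else 1) +
      Finsupp.single (moveTo c' q₂ b₂) ((√2 : ℝ) : ℂ)⁻¹ := by
  rw [PreQTM.stepLinear_single]
  erw [hc, succ_eq]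
  simp only [mixBasis, hcoin, if_true, Finsupp.mapDomain_add, Finsupp.mapDomain_single,
    advance_eq h₁, advance_toggle_eq h₂]

end CoinMachine

/-! ### Words of a given length -/

/-- The words of length `n`. -/
def words (n : ℕ) : Finset (List Bool) := Finset.univ.map ⟨List.ofFn (n := n), List.ofFn_injective⟩

@[simp] theorem mem_words {n : ℕ} {w : List Bool} : w ∈ words n ↔ w.length = n := by
  simp only [words, Finset.mem_map, Finset.mem_univ, true_and, Function.Embedding.coeFn_mk]
  constructor
  · rintro ⟨f, rfl⟩; simp
  · rintro rfl; exact ⟨w.get, by simp⟩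

@[simp] theorem card_words (n : ℕ) : (words n).card = 2 ^ n := by
  simp [words]

theorem sum_words_zero {R : Type*} [AddCommMonoid R] (f : List Bool → R) :
    ∑ w ∈ words 0, f w = f [] := by
  rw [Finset.sum_eq_single []]
  · intro w hw h; simp_all
  · simp

theorem sum_words_cons {R : Type*} [AddCommMonoid R] (n : ℕ) (f : List Bool → R) :
    ∑ w ∈ words (n + 1), f w = ∑ w ∈ words n, (f (false :: w) + f (true :: w)) := by
  have : ∑ w ∈ words (n + 1), f w =
      ∑ p ∈ words n ×ˢ (Finset.univ : Finset Bool), f (p.2 :: p.1) := by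
    refine Finset.sum_nbij' (fun w => (w.tail, w.headI)) (fun p => p.2 :: p.1) ?_ ?_ ?_ ?_ ?_
    · intro w hw; simp_all
    · intro w hw; simp_all
    · rintro (_ | ⟨a, w⟩) hw <;> simp_all
    · intro w hw; simp
    · rintro (_ | ⟨a, w⟩) hw <;> simp_all
  rw [this, Finset.sum_product]
  refine Finset.sum_congr rfl fun w _ => ?_
  rw [Fintype.sum_bool, add_comm]

theorem sum_words_snoc {R : Type*} [AddCommMonoid R] (n : ℕ) (f : List Bool → R) :
    ∑ w ∈ words (n + 1), f w = ∑ w ∈ words n, (f (w ++ [false]) + f (w ++ [true])) := by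
  have rev : ∀ (n : ℕ) (f : List Bool → R), ∑ w ∈ words n, f w.reverse = ∑ w ∈ words n, f w :=
    fun n f => Finset.sum_nbij' List.reverse List.reverse (by simp) (by simp) (by simp) (by simp)
      (by simp)
  rw [← rev, sum_words_cons, ← rev]
  simp

/-! ### Tapes that hold a word -/

namespace Tape

variable {s : ℕ}

theorem cells_ofWord_natCast (x : List Bool) (k : ℕ) :
    (ofWord x : Tape s).cells (k : ℤ) = (x.map Sym.bit).getD k Sym.blank := by
  have : ((k : ℕ) : ℤ) = (Nat.castEmbedding (R := ℤ)) k := rfl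
  rw [ofWord, this]
  simp only [Finsupp.embDomain_apply_self]
  rfl

theorem cells_ofWord_of_neg (x : List Bool) {i : ℤ} (hi : i < 0) :
    (ofWord x : Tape s).cells i = Sym.blank := by
  simp only [ofWord]
  rw [Finsupp.embDomain_of_notMem_range]
  · rfl
  · rintro ⟨k, rfl⟩
    simp at hi
    omega

theorem cells_ofWord_of_le (x : List Bool) {i : ℤ} (hi : x.length ≤ i) :
    (ofWord x : Tape s).cells i = Sym.blank := by
  obtain ⟨k, rfl⟩ := Int.eq_ofNat_of_zero_le (show 0 ≤ i by omega)
  rw [cells_ofWord_natCast, List.getD_eq_default]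
  simp; omega

theorem cells_ofWord_append_cons (x y : List Bool) (b : Bool) :
    (ofWord (x ++ b :: y) : Tape s).cells x.length = Sym.bit b := by
  rw [cells_ofWord_natCast]
  simp

theorem read_ofWord_append (x y : List Bool) (b : Bool) :
    (⟨(ofWord (x ++ b :: y)).cells, x.length⟩ : Tape s).read = Sym.bit b :=
  cells_ofWord_append_cons _ _ _

theorem read_ofWord_of_le (x : List Bool) {i : ℤ} (hi : x.length ≤ i) :
    (⟨(ofWord x).cells, i⟩ : Tape s).read = Sym.blank :=
  cells_ofWord_of_le _ hi

theorem cells_ofWord_snoc_of_ne (u : List Bool) (b : Bool) {i : ℤ} (hi : i ≠ u.length) :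
    (ofWord (u ++ [b]) : Tape s).cells i = (ofWord u).cells i := by
  rcases lt_or_ge i 0 with h0 | h0
  · rw [cells_ofWord_of_neg _ h0, cells_ofWord_of_neg _ h0]
  · obtain ⟨k, rfl⟩ := Int.eq_ofNat_of_zero_le h0
    rw [cells_ofWord_natCast, cells_ofWord_natCast]
    have : k ≠ u.length := by simpa using hi
    by_cases hk : k < u.length
    · simp [List.getD_eq_getElem?_getD, List.getElem?_append, hk]
    · rw [List.getD_eq_default _ _ (by simp; omega), List.getD_eq_default _ _ (by simp; omega)]

theorem update_ofWord_snoc (u : List Bool) (b b' : Bool) :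
    (ofWord (u ++ [b]) : Tape s).cells.update u.length (Sym.bit b') =
      (ofWord (u ++ [b'])).cells := by
  classical
  ext i
  rw [Finsupp.update_apply]
  split_ifs with h
  · rw [h, cells_ofWord_append_cons]
  · rw [cells_ofWord_snoc_of_ne _ _ h, cells_ofWord_snoc_of_ne _ _ h]

theorem update_ofWord_snoc_blank (u : List Bool) (b : Bool) :
    (ofWord (u ++ [b]) : Tape s).cells.update u.length Sym.blank = (ofWord u).cells := by
  classical
  ext i
  rw [Finsupp.update_apply]
  split_ifs with h
  · rw [h, cells_ofWord_of_le _ le_rfl]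
  · exact cells_ofWord_snoc_of_ne _ _ h

theorem update_ofWord (u : List Bool) (b : Bool) :
    (ofWord u : Tape s).cells.update u.length (Sym.bit b) = (ofWord (u ++ [b])).cells := by
  classical
  rw [← update_ofWord_snoc_blank u b, ← update_ofWord_snoc u b b]
  ext i
  simp only [Finsupp.update_apply]
  split_ifs <;> rfl

theorem update_ofWord_of_blank (u : List Bool) {i : ℤ} (hi : u.length ≤ i) :
    (ofWord u : Tape s).cells.update i Sym.blank = (ofWord u).cells := by
  classical
  ext j
  rw [Finsupp.update_apply]
  split_ifs with h
  · rw [h, cells_ofWord_of_le _ hi]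
  · rfl

theorem empty_eq : (empty : Tape s) = ⟨(ofWord []).cells, 0⟩ := by
  simp only [empty, Tape.mk.injEq, and_true]
  ext i
  rcases lt_or_ge i 0 with h | h
  · rw [cells_ofWord_of_neg _ h]; rfl
  · rw [cells_ofWord_of_le _ (by simpa using h)]; rfl

theorem queryWord_ofWord (u : List Bool) :
    (⟨(ofWord u : Tape s).cells, u.length⟩ : Tape s).queryWord = u := by
  have hcell : ∀ k (hk : k < u.length), (ofWord u : Tape s).cells (k : ℤ) = Sym.bit u[k] := by
    intro k hk
    rw [cells_ofWord_natCast]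
    simp [List.getD_eq_getElem?_getD, hk]
  have hl : (⟨(ofWord u : Tape s).cells, u.length⟩ : Tape s).queryLength = u.length := by
    unfold queryLength
    dsimp only
    refine le_antisymm (Nat.sInf_le ?_) (le_csInf ⟨u.length, ?_⟩ ?_)
    · intro b
      rw [cells_ofWord_of_neg _ (by omega)]
      simp
    · intro b
      rw [cells_ofWord_of_neg _ (by omega)]
      simp
    · intro j hj
      by_contra hlt
      have e : (u.length : ℤ) - 1 - j = ((u.length - 1 - j : ℕ) : ℤ) := by omega
      rw [Set.mem_ofPred_eq] at hj
      rw [e, hcell _ (by omega)] at hj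
      exact hj _ rfl
  unfold queryWord
  refine List.ext_getElem (by simp [hl]) fun i h1 h2 => ?_
  simp only [List.getElem_ofFn, hl, Fin.val_cast]
  have : (u.length : ℤ) - u.length + i = i := by ring
  rw [this, hcell i h2]
  simp

open Classical in
theorem callOracle_ofWord_snoc (A : Language Bool) (u : List Bool) (b : Bool) :
    (⟨(ofWord (u ++ [b]) : Tape s).cells, u.length⟩ : Tape s).callOracle A =
      ⟨(ofWord (u ++ [xor b (decide (u ∈ A))])).cells, u.length⟩ := by
  have hq : (⟨(ofWord (u ++ [b]) : Tape s).cells, u.length⟩ : Tape s).queryWord = u := by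
    conv_rhs => rw [← queryWord_ofWord (s := s) u]
    refine queryWord_congr rfl fun i hi => ?_
    dsimp only at hi ⊢
    rw [← update_ofWord, Finsupp.update_apply, if_neg hi.ne]
  have hr : (⟨(ofWord (u ++ [b]) : Tape s).cells, u.length⟩ : Tape s).read = Sym.bit b :=
    cells_ofWord_append_cons u [] b
  unfold callOracle
  simp only [hr]
  rw [hq, update_ofWord_snoc]

end Tape

/-! ### The inner machine: zero-error evaluation of a block -/

/-- The word `w₁ j₁ w₂ j₂ …`. -/
def interleave : List Bool → List Bool → List Bool
  | a :: w, r :: j => a :: r :: interleave w j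
  | _, _ => []

/-- The transitions of the block machine. In the states `0` and `1` it copies the input to the query
tape and puts a random bit after each letter. The states `2` and `4` make an oracle call,
and the states `5`, `6` and `7` show the result. -/
def blockTable : Sym 1 → Fin 8 × Sym 1 → Option (Fin 8 × Sym 1)
  | .bit x, (0, .blank) => some (1, .bit x)
  | .bit _, (1, .blank) => some (0, .bit false)
  | .bit _, (1, .mark _) => some (0, .bit true)
  | .blank, (0, .blank) => some (2, .bit false)
  | .blank, (2, .bit false) => some (3, .bit false)
  | .blank, (2, .bit true) => some (5, .bit true)
  | .blank, (3, .blank) => some (4, .bit false)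
  | .blank, (4, .bit true) => some (6, .bit true)
  | .blank, (4, .bit false) => some (7, .bit false)
  | .blank, (5, .blank) => some (5, .blank)
  | _, _ => none

theorem blockTable_injective (a : Sym 1) (x y : Fin 8 × Sym 1) :
    (blockTable a x).isSome → blockTable a x = blockTable a y → x = y := by
  revert a x y
  decide

/-- The machine that determines the type of the block of its input. -/
def blockMachine : CoinMachine where
  numStates := 8
  start := 0
  isQuery q := q = 2 ∨ q = 4
  output q := if q = 5 then some false else if q = 6 then some true else none
  coin q _ := q = 1
  dir := ![(.right, .right), (.stay, .right), (.stay, .stay), (.stay, .right), (.stay, .stay),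
    (.stay, .right), (.stay, .stay), (.stay, .stay)]
  perm a := (exists_perm_extending (blockTable a) (blockTable_injective a)).choose

theorem blockMachine_perm {a : Sym 1} {x y : Fin 8 × Sym 1} (h : blockTable a x = some y) :
    blockMachine.perm a x = y :=
  (exists_perm_extending (blockTable a) (blockTable_injective a)).choose_spec x y h

namespace blockMachine

/-- The configuration with state `q`, input `x`, and the word `u` on the query tape. -/
def conf (q : Fin 8) (x : List Bool) (i : ℤ) (u : List Bool) (k : ℤ) : blockMachine.frame.Cfg :=
  ⟨q, ⟨(Tape.ofWord x).cells, i⟩, ⟨(Tape.ofWord u).cells, k⟩⟩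

theorem init_eq (x : List Bool) : blockMachine.frame.init x = conf 0 x 0 [] 0 := by
  rw [conf, ← Tape.empty_eq]
  rfl

theorem callOracle_conf (A : Language Bool) {q : Fin 8} (hq : q ≠ 2 ∧ q ≠ 4) (x : List Bool)
    (i : ℤ) (u : List Bool) (k : ℤ) : (conf q x i u k).callOracle A = conf q x i u k :=
  Frame.Cfg.callOracle_of_not_isQuery A (by simp [conf, blockMachine, hq])

open Classical in
theorem callOracle_conf_query (A : Language Bool) {q : Fin 8} (hq : q = 2 ∨ q = 4) (x : List Bool)
    (i : ℤ) (u : List Bool) : (conf q x i (u ++ [false]) u.length).callOracle A =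
      conf q x i (u ++ [decide (u ∈ A)]) u.length := by
  have : blockMachine.frame.isQuery (conf q x i (u ++ [false]) u.length).state = true := by
    simp [conf, blockMachine, hq]
  rw [Frame.Cfg.callOracle, if_pos this]
  simp only [conf, Tape.callOracle_ofWord_snoc, Bool.false_xor]

variable (A : Language Bool) (pre rest x u : List Bool) (a r : Bool)

theorem step_copy : blockMachine.toPTM.step A (conf 0 (pre ++ a :: rest) pre.length u u.length) r =
    conf 1 (pre ++ a :: rest) pre.length (u ++ [a]) (u ++ [a]).length := by
  rw [CoinMachine.toPTM_step_eq (callOracle_conf A (by decide) _ _ _ _) (q := (1 : Fin 8))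
    (b := .bit a)]
  · simp [conf, CoinMachine.moveTo, Tape.update_ofWord, blockMachine, Move.shift]
  · simp only [conf, Tape.read_ofWord_append, Tape.read_ofWord_of_le u le_rfl]
    exact blockMachine_perm (by simp [blockMachine, blockTable])

theorem step_coin : blockMachine.toPTM.step A (conf 1 (pre ++ a :: rest) pre.length u u.length) r =
    conf 0 (pre ++ a :: rest) (pre ++ [a]).length (u ++ [r]) (u ++ [r]).length := by
  rw [CoinMachine.toPTM_step_eq (callOracle_conf A (by decide) _ _ _ _) (q := (0 : Fin 8))
    (b := .bit r)]
  · simp [conf, CoinMachine.moveTo, Tape.update_ofWord, blockMachine, Move.shift]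
  · simp only [conf, Tape.read_ofWord_append, Tape.read_ofWord_of_le u le_rfl]
    refine blockMachine_perm ?_
    cases r <;> simp [blockMachine, blockTable, Sym.toggle]

theorem step_zero_end : blockMachine.toPTM.step A (conf 0 x x.length u u.length) r =
    conf 2 x x.length (u ++ [false]) u.length := by
  rw [CoinMachine.toPTM_step_eq (callOracle_conf A (by decide) _ _ _ _) (q := (2 : Fin 8))
    (b := .bit false)]
  · simp [conf, CoinMachine.moveTo, Tape.update_ofWord, blockMachine, Move.shift]
  · simp only [conf, Tape.read_ofWord_of_le _ le_rfl]
    exact blockMachine_perm (by simp [blockMachine, blockTable])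

theorem step_three : blockMachine.toPTM.step A (conf 3 x x.length u u.length) r =
    conf 4 x x.length (u ++ [false]) u.length := by
  rw [CoinMachine.toPTM_step_eq (callOracle_conf A (by decide) _ _ _ _) (q := (4 : Fin 8))
    (b := .bit false)]
  · simp [conf, CoinMachine.moveTo, Tape.update_ofWord, blockMachine, Move.shift]
  · simp only [conf, Tape.read_ofWord_of_le _ le_rfl]
    exact blockMachine_perm (by simp [blockMachine, blockTable])

theorem step_five {k : ℤ} (hk : u.length ≤ k) :
    blockMachine.toPTM.step A (conf 5 x x.length u k) r = conf 5 x x.length u (k + 1) := by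
  rw [CoinMachine.toPTM_step_eq (callOracle_conf A (by decide) _ _ _ _) (q := (5 : Fin 8))
    (b := .blank)]
  · simp [conf, CoinMachine.moveTo, Tape.update_ofWord_of_blank _ hk, blockMachine, Move.shift]
  · simp only [conf, Tape.read_ofWord_of_le _ le_rfl, Tape.read_ofWord_of_le _ hk]
    exact blockMachine_perm (by simp [blockMachine, blockTable])

open Classical in
theorem step_two : blockMachine.toPTM.step A (conf 2 x x.length (u ++ [false]) u.length) r =
    conf (if u ∈ A then 5 else 3) x x.length (u ++ [decide (u ∈ A)]) (u.length + 1) := by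
  rw [CoinMachine.toPTM_step_eq (callOracle_conf_query A (by decide) _ _ _)
    (q := (if u ∈ A then 5 else 3 : Fin 8)) (b := .bit (decide (u ∈ A)))]
  · by_cases hu : u ∈ A <;>
      simp [hu, conf, CoinMachine.moveTo, Tape.update_ofWord_snoc, blockMachine, Move.shift]
  · simp only [conf, Tape.read_ofWord_of_le _ le_rfl, Tape.read_ofWord_append]
    refine blockMachine_perm ?_
    by_cases hu : u ∈ A <;> simp [hu, blockMachine, blockTable]

open Classical in
theorem step_four : blockMachine.toPTM.step A (conf 4 x x.length (u ++ [false]) u.length) r =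
    conf (if u ∈ A then 6 else 7) x x.length (u ++ [decide (u ∈ A)]) u.length := by
  rw [CoinMachine.toPTM_step_eq (callOracle_conf_query A (by decide) _ _ _)
    (q := (if u ∈ A then 6 else 7 : Fin 8)) (b := .bit (decide (u ∈ A)))]
  · by_cases hu : u ∈ A <;>
      simp [hu, conf, CoinMachine.moveTo, Tape.update_ofWord_snoc, blockMachine, Move.shift]
  · simp only [conf, Tape.read_ofWord_of_le _ le_rfl, Tape.read_ofWord_append]
    refine blockMachine_perm ?_
    by_cases hu : u ∈ A <;> simp [hu, blockMachine, blockTable]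

/-- The output after the oracle calls with the words `u` and `u ++ [false]`. -/
def verdict : Option Bool :=
  open Classical in
  if u ∈ A then some false else if u ++ [false] ∈ A then some true else none

/-- The indicator function of the words `u` for which the output is `b`. -/
def hit (b : Bool) : ℝ := if verdict A u = some b then 1 else 0

/-- When the first call fails, its answer bit `false` stays on the tape and becomes the last letter
of the second query word. When it succeeds, state `5` uses up the two spare steps by moving right
over blanks, since resting on the answer bit would break injectivity of the table. -/
theorem step_four_times (r₁ r₂ r₃ r₄ : Bool) :
    blockMachine.output (blockMachine.toPTM.step A (blockMachine.toPTM.step A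
      (blockMachine.toPTM.step A (blockMachine.toPTM.step A (conf 0 x x.length u u.length) r₁)
        r₂) r₃) r₄).state = verdict A u := by
  rw [step_zero_end, step_two]
  unfold verdict
  by_cases hu : u ∈ A
  · simp only [hu, if_true]
    rw [step_five _ _ _ _ (by simp), step_five _ _ _ _ (by simp)]
    simp [conf, blockMachine]
  · simp only [hu, if_false, decide_false]
    have := step_three A x (u ++ [false]) r₃
    simp only [List.length_append, List.length_singleton, Nat.cast_add, Nat.cast_one] at this
    rw [this]
    have := step_four A x (u ++ [false]) r₄
    simp only [List.length_append, List.length_singleton, Nat.cast_add, Nat.cast_one] at this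
    rw [this]
    split_ifs <;> simp [conf, blockMachine]

theorem outputProb_conf (b : Bool) :
    blockMachine.toPTM.outputProb A b (2 * rest.length + 4)
      (conf 0 (pre ++ rest) pre.length u u.length) =
      (∑ j ∈ words rest.length, hit A (u ++ interleave rest j) b) / 2 ^ rest.length := by
  induction rest generalizing pre u with
  | nil =>
    simp only [List.append_nil, List.length_nil, sum_words_zero, interleave, pow_zero, div_one]
    simp only [PTM.outputProb, step_four_times, hit]
    ring
  | cons a rest ih =>
    rw [List.length_cons, show 2 * (rest.length + 1) + 4 = (2 * rest.length + 4) + 2 by ring]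
    have h := fun r => ih (pre ++ [a]) (u ++ [a] ++ [r])
    simp only [List.append_assoc, List.singleton_append] at h
    -- With the remaining time opaque, unfolding stops after the two steps that handle one letter.
    generalize 2 * rest.length + 4 = m at h ⊢
    simp only [PTM.outputProb, step_copy, step_coin]
    simp only [List.append_assoc, List.cons_append, List.nil_append, h, sum_words_cons,
      Finset.sum_add_distrib, interleave]
    field_simp
    ring

/-- The only coin state is `1`, and it is entered with the query head on the blank just after the
word written so far. -/
theorem fresh_conf : CoinMachine.Fresh A (2 * rest.length + 4)
    (conf 0 (pre ++ rest) pre.length u u.length) := by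
  have hcoin : ∀ (q : Fin 8) x i u k, q ≠ 1 →
      ¬ blockMachine.coin (conf q x i u k).state (conf q x i u k).work.read = true := by
    intro q x i u k hq
    simp [conf, blockMachine, hq]
  induction rest generalizing pre u with
  | nil =>
    simp only [List.append_nil]
    refine ⟨fun h => absurd h (hcoin _ _ _ _ _ (by decide)), fun r => ?_⟩
    rw [step_zero_end]
    refine ⟨fun h => absurd h (hcoin _ _ _ _ _ (by decide)), fun r => ?_⟩
    rw [step_two]
    by_cases hu : u ∈ A
    · simp only [hu, if_true]
      refine ⟨fun h => absurd h (hcoin _ _ _ _ _ (by decide)), fun r => ?_⟩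
      rw [step_five _ _ _ _ (by simp)]
      exact ⟨fun h => absurd h (hcoin _ _ _ _ _ (by decide)), fun r => trivial⟩
    · simp only [hu, if_false, decide_false]
      refine ⟨fun h => absurd h (hcoin _ _ _ _ _ (by decide)), fun r => ?_⟩
      have := step_three A pre (u ++ [false]) r
      simp only [List.length_append, List.length_singleton, Nat.cast_add, Nat.cast_one] at this
      rw [this]
      exact ⟨fun h => absurd h (hcoin _ _ _ _ _ (by decide)), fun r => trivial⟩
  | cons a rest ih =>
    rw [List.length_cons, show 2 * (rest.length + 1) + 4 = (2 * rest.length + 4) + 2 by ring]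
    refine ⟨fun h => absurd h (hcoin _ _ _ _ _ (by decide)), fun r => ?_⟩
    rw [step_copy]
    refine ⟨fun _ => ?_, fun r => ?_⟩
    · rw [callOracle_conf A (by decide)]
      simp only [conf]
      rw [Tape.read_ofWord_of_le _ le_rfl]
      rfl
    · rw [step_coin]
      simpa using ih (pre ++ [a]) (u ++ [a] ++ [r])

theorem prob_eq (b : Bool) : blockMachine.toPTM.prob A (2 * x.length + 4) b x =
    (∑ j ∈ words x.length, hit A (interleave x j) b) / 2 ^ x.length := by
  rw [PTM.prob_eq_outputProb]
  refine (congrArg _ (init_eq x)).trans ?_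
  simpa using outputProb_conf A [] x [] b

theorem toQTM_prob_eq (b : Bool) : blockMachine.toQTM.prob A (2 * x.length + 4) b x =
    blockMachine.toPTM.prob A (2 * x.length + 4) b x := by
  refine CoinMachine.toQTM_prob_eq A _ b x ?_
  rw [init_eq]
  simpa using fresh_conf A [] x []

end blockMachine

/-! ### Block encodings and their zero-error decoding. -/

/-- The block of `w` encodes the bit `0`. -/
def BlockZero (A : Language Bool) (w : List Bool) : Prop :=
  open Classical in
  2 ^ w.length ≤ 2 * ((words w.length).filter fun j => interleave w j ∈ A).card ∧
    ∀ j ∈ words w.length, interleave w j ++ [false] ∉ A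

/-- The block of `w` encodes the bit `1`. -/
def BlockOne (A : Language Bool) (w : List Bool) : Prop :=
  open Classical in
  2 ^ w.length ≤ 2 * ((words w.length).filter fun j => interleave w j ++ [false] ∈ A).card ∧
    ∀ j ∈ words w.length, interleave w j ∉ A

/-- The language of the words whose block encodes `1`. -/
def decoded (A : Language Bool) : Language Bool := {w | BlockOne A w}

theorem isZeroError_blockMachine {A : Language Bool} (hA : ∀ w, BlockZero A w ∨ BlockOne A w) :
    IsZeroError (fun b x => blockMachine.toPTM.prob A (2 * x.length + 4) b x) (decoded A) := by
  classical
  intro x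
  simp only [blockMachine.prob_eq, blockMachine.hit]
  have hone : BlockOne A x → ∀ j ∈ words x.length, blockMachine.verdict A (interleave x j) =
      if interleave x j ++ [false] ∈ A then some true else none := fun h j hj => by
    rw [blockMachine.verdict, if_neg (h.2 j hj)]
  have hzero : BlockZero A x → ∀ j ∈ words x.length, blockMachine.verdict A (interleave x j) =
      if interleave x j ∈ A then some false else none := fun h j hj => by
    rw [blockMachine.verdict, if_neg (h.2 j hj)]
  have half : ∀ k : ℕ, 2 ^ x.length ≤ 2 * k → 1 / 2 ≤ (k : ℝ) / 2 ^ x.length := fun k hk => by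
    rw [div_le_div_iff₀ (by norm_num) (by positivity)]
    have : ((2 ^ x.length : ℕ) : ℝ) ≤ ((2 * k : ℕ) : ℝ) := by exact_mod_cast hk
    push_cast at this
    linarith
  constructor
  · intro hx
    constructor
    · rw [Finset.sum_congr rfl fun j hj => by rw [hone hx j hj]]
      convert half _ hx.1
      rw [Finset.card_filter]
      push_cast
      refine Finset.sum_congr rfl fun j _ => ?_
      split_ifs <;> simp_all
    · rw [Finset.sum_eq_zero, zero_div]
      intro j hj
      rw [hone hx j hj]
      split_ifs <;> simp_all
  · intro hx
    have hx := (hA x).resolve_right hx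
    constructor
    · rw [Finset.sum_congr rfl fun j hj => by rw [hzero hx j hj]]
      convert half _ hx.1
      rw [Finset.card_filter]
      push_cast
      refine Finset.sum_congr rfl fun j _ => ?_
      split_ifs <;> simp_all
    · rw [Finset.sum_eq_zero, zero_div]
      intro j hj
      rw [hzero hx j hj]
      split_ifs <;> simp_all

theorem decoded_mem_ZPP {A : Language Bool} (hA : ∀ w, BlockZero A w ∨ BlockOne A w) :
    decoded A ∈ ZPP A :=
  ⟨blockMachine.toPTM, 2 * Polynomial.X + 4, by
    simpa using isZeroError_blockMachine hA⟩

theorem decoded_mem_ZQP {A : Language Bool} (hA : ∀ w, BlockZero A w ∨ BlockOne A w) :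
    decoded A ∈ ZQP A :=
  ⟨blockMachine.toQTM, 2 * Polynomial.X + 4, by
    simpa [blockMachine.toQTM_prob_eq] using isZeroError_blockMachine hA⟩

/-! ### The outer machine: the Deutsch–Jozsa algorithm -/

/-- The transitions of the Deutsch–Jozsa machine. In state `0` it writes a random word on the query
tape, in state `1` it prepares the target cell, in state `2` it calls the oracle, and in state `3`
it goes back and transforms the query word again. State `4` shows that this word was not zero. -/
def djTable : Sym 1 → Fin 5 × Sym 1 → Option (Fin 5 × Sym 1)
  | .bit _, (0, .blank) => some (0, .bit false)
  | .bit _, (0, .mark _) => some (0, .bit true)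
  | .blank, (0, .blank) => some (1, .mark 0)
  | .blank, (1, .blank) => some (2, .bit false)
  | .blank, (1, .mark _) => some (2, .bit true)
  | .blank, (2, .bit b) => some (3, .bit b)
  | .blank, (3, .bit false) => some (3, .blank)
  | .blank, (3, .bit true) => some (4, .blank)
  | .blank, (4, .bit b) => some (4, .bit b)
  | _, _ => none

theorem djTable_injective (a : Sym 1) (x y : Fin 5 × Sym 1) :
    (djTable a x).isSome → djTable a x = djTable a y → x = y := by
  revert a x y
  decide

/-- The Deutsch–Jozsa machine. -/
def djMachine : CoinMachine where
  numStates := 5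
  start := 0
  isQuery q := q = 2
  output q := some (q = 3)
  coin q a := (q = 0 ∧ a ≠ .blank) ∨ q = 1 ∨ q = 3
  dir := ![(.right, .right), (.stay, .stay), (.stay, .stay), (.stay, .left), (.stay, .left)]
  perm a := (exists_perm_extending (djTable a) (djTable_injective a)).choose

theorem djMachine_perm {a : Sym 1} {x y : Fin 5 × Sym 1} (h : djTable a x = some y) :
    djMachine.perm a x = y :=
  (exists_perm_extending (djTable a) (djTable_injective a)).choose_spec x y h

namespace djMachine

/-- The configuration with state `q`, input `x` and query tape `t`. -/
def conf (q : Fin 5) (x : List Bool) (i : ℤ) (t : Tape 1) : djMachine.frame.Cfg :=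
  ⟨q, ⟨(Tape.ofWord x).cells, i⟩, t⟩

/-- The query tape with the word `u`, the bit `b` in cell `n`, and head at the last letter. -/
def backTape (n : ℕ) (u : List Bool) (b : Bool) : Tape 1 :=
  ⟨(Tape.ofWord u).cells.update n (.bit b), u.length - 1⟩

theorem init_eq (x : List Bool) :
    djMachine.frame.init x = conf 0 x 0 ⟨(Tape.ofWord []).cells, 0⟩ := by
  rw [conf, ← Tape.empty_eq]
  rfl

theorem callOracle_eq (B : Language Bool) {c : djMachine.frame.Cfg}
    (hq : djMachine.isQuery c.state = false) : c.callOracle B = c :=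
  Frame.Cfg.callOracle_of_not_isQuery B hq

/-- One step of the machine. -/
abbrev stepL (B : Language Bool) :
    (djMachine.frame.Cfg →₀ ℂ) →ₗ[ℂ] (djMachine.frame.Cfg →₀ ℂ) :=
  djMachine.toPreQTM.stepLinear B

/-- The factor `1 / √2`. -/
abbrev amp : ℂ := ((√2 : ℝ) : ℂ)⁻¹

/-- The phase that an oracle call with the word `w` produces. -/
def phase (B : Language Bool) (w : List Bool) : ℂ :=
  open Classical in if w ∈ B then -1 else 1

variable (B : Language Bool)

theorem stepL_zero (pre rest u : List Bool) (a : Bool) :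
    stepL B (Finsupp.single (conf 0 (pre ++ a :: rest) pre.length
      ⟨(Tape.ofWord u).cells, u.length⟩) 1) =
    amp • (Finsupp.single (conf 0 (pre ++ a :: rest) (pre.length + 1)
        ⟨(Tape.ofWord (u ++ [false])).cells, u.length + 1⟩) 1 +
      Finsupp.single (conf 0 (pre ++ a :: rest) (pre.length + 1)
        ⟨(Tape.ofWord (u ++ [true])).cells, u.length + 1⟩) 1) := by
  rw [CoinMachine.stepLinear_single_coin (callOracle_eq B rfl)
    (q₁ := (0 : Fin 5)) (b₁ := .bit false) (q₂ := (0 : Fin 5)) (b₂ := .bit true)]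
  · rw [smul_add, Finsupp.smul_single_one, Finsupp.smul_single_one]
    simp [conf, CoinMachine.moveTo, Tape.update_ofWord, djMachine, Move.shift,
      Tape.read_ofWord_of_le u le_rfl, Sym.isOne]
  · simp [conf, Tape.read_ofWord_append, djMachine]
  · simp only [conf, Tape.read_ofWord_append, Tape.read_ofWord_of_le u le_rfl]
    exact djMachine_perm rfl
  · simp only [conf, Tape.read_ofWord_append, Tape.read_ofWord_of_le u le_rfl]
    exact djMachine_perm rfl

/-- The mark is second in its pair, so its Hadamard transform carries the minus sign that the target
bit needs for phase kickback. -/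
theorem stepL_stepL_end (x u : List Bool) :
    stepL B (stepL B (Finsupp.single (conf 0 x x.length ⟨(Tape.ofWord u).cells, u.length⟩) 1)) =
    amp • (Finsupp.single (conf 2 x x.length ⟨(Tape.ofWord (u ++ [false])).cells, u.length⟩) 1 -
      Finsupp.single (conf 2 x x.length ⟨(Tape.ofWord (u ++ [true])).cells, u.length⟩) 1) := by
  classical
  have hup : ∀ b, ((Tape.ofWord u : Tape 1).cells.update u.length (.mark 0)).update u.length
      (.bit b) = (Tape.ofWord (u ++ [b])).cells := fun b => by
    rw [← Tape.update_ofWord]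
    ext i
    simp only [Finsupp.update_apply]
    split_ifs <;> rfl
  have h1 : stepL B (Finsupp.single (conf 0 x x.length ⟨(Tape.ofWord u).cells, u.length⟩) 1) =
      Finsupp.single (conf 1 x x.length
        ⟨(Tape.ofWord u).cells.update u.length (.mark 0), u.length⟩) 1 := by
    rw [CoinMachine.stepLinear_single_eq (callOracle_eq B rfl)
      (q := (1 : Fin 5)) (b := .mark 0)]
    · simp [conf, CoinMachine.moveTo, djMachine, Move.shift]
    · simp [conf, Tape.read_ofWord_of_le _ le_rfl, djMachine]
    · simp only [conf, Tape.read_ofWord_of_le _ le_rfl]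
      exact djMachine_perm rfl
  have hr : (⟨(Tape.ofWord u : Tape 1).cells.update u.length (.mark 0), u.length⟩ : Tape 1).read =
      .mark 0 := by simp [Tape.read, Finsupp.update_apply]
  rw [h1, CoinMachine.stepLinear_single_coin (callOracle_eq B rfl)
    (q₁ := (2 : Fin 5)) (b₁ := .bit true) (q₂ := (2 : Fin 5)) (b₂ := .bit false)]
  · rw [smul_sub, Finsupp.smul_single_one, Finsupp.smul_single_one, add_comm,
      sub_eq_add_neg]
    simp [conf, CoinMachine.moveTo, hup, djMachine, Move.shift, hr, Sym.isOne]
    rfl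
  · simp [conf, djMachine]
  · simp only [conf, Tape.read_ofWord_of_le _ le_rfl, hr]
    exact djMachine_perm rfl
  · simp only [conf, Tape.read_ofWord_of_le _ le_rfl, hr]
    exact djMachine_perm rfl

theorem stepL_query (x u : List Bool) :
    stepL B (Finsupp.single (conf 2 x x.length
        ⟨(Tape.ofWord (u ++ [false])).cells, u.length⟩) 1 -
      Finsupp.single (conf 2 x x.length ⟨(Tape.ofWord (u ++ [true])).cells, u.length⟩) 1) =
    phase B u • (Finsupp.single (conf 3 x x.length (backTape u.length u false)) 1 -
      Finsupp.single (conf 3 x x.length (backTape u.length u true)) 1) := by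
  classical
  have h : ∀ b, stepL B (Finsupp.single (conf 2 x x.length
      ⟨(Tape.ofWord (u ++ [b])).cells, u.length⟩) 1) =
      Finsupp.single (conf 3 x x.length (backTape u.length u (xor b (decide (u ∈ B))))) 1 := by
    intro b
    have hc : (conf 2 x x.length ⟨(Tape.ofWord (u ++ [b])).cells, u.length⟩).callOracle B =
        conf 2 x x.length ⟨(Tape.ofWord (u ++ [xor b (decide (u ∈ B))])).cells, u.length⟩ := by
      rw [Frame.Cfg.callOracle, if_pos (by simp [conf, djMachine])]
      simp only [conf, Tape.callOracle_ofWord_snoc]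
    rw [CoinMachine.stepLinear_single_eq hc
      (q := (3 : Fin 5)) (b := .bit (xor b (decide (u ∈ B))))]
    · simp [conf, CoinMachine.moveTo, djMachine, Move.shift, backTape, Tape.update_ofWord_snoc,
        Tape.update_ofWord, sub_eq_add_neg]
    · simp [conf, djMachine]
    · simp only [conf, Tape.read_ofWord_of_le _ le_rfl, Tape.read_ofWord_append]
      exact djMachine_perm rfl
  rw [map_sub, h, h]
  -- A positive answer swaps the two target values, that is, negates their difference.
  by_cases hu : u ∈ B <;> simp [hu, phase]

/-- The superpositions of configurations in state `4` that will move over `m` more bits. -/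
def bad (m : ℕ) : Submodule ℂ (djMachine.frame.Cfg →₀ ℂ) :=
  Finsupp.supported ℂ ℂ {c | c.state = (4 : Fin 5) ∧ c.work.read = .blank ∧
    c.query.head = (m : ℤ) - 1 ∧ ∀ i : ℕ, i < m → ∃ b, c.query.cells (i : ℤ) = .bit b}

/-- State `4` tosses no coin and scans a bit, so the machine stays in it and moves one cell to the
left: a rejecting component never returns to state `3`. -/
theorem stepL_bad {m : ℕ} {φ : djMachine.frame.Cfg →₀ ℂ} (hφ : φ ∈ bad (m + 1)) :
    stepL B φ ∈ bad m := by
  classical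
  rw [bad, Finsupp.supported_eq_span_single] at hφ
  induction hφ using Submodule.span_induction with
  | zero => simp
  | add φ ψ _ _ h1 h2 => rw [map_add]; exact add_mem h1 h2
  | smul a φ _ h => rw [map_smul]; exact Submodule.smul_mem _ _ h
  | mem φ h =>
    obtain ⟨c, ⟨hs, hw, hh, hc⟩, rfl⟩ := h
    have hm : c.query.head = (m : ℤ) := by rw [hh]; push_cast; ring
    obtain ⟨b, hb⟩ := hc m (by omega)
    have hr : c.query.read = .bit b := by rw [Tape.read, hm, hb]
    dsimp only
    rw [CoinMachine.stepLinear_single_eq (callOracle_eq B (by rw [hs]; rfl))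
      (q := (4 : Fin 5)) (b := .bit b)]
    · refine Finsupp.single_mem_supported _ _ ⟨rfl, ?_, ?_, ?_⟩
      · simpa [CoinMachine.moveTo, djMachine, Move.shift] using hw
      · simp [CoinMachine.moveTo, djMachine, Move.shift, hm, sub_eq_add_neg]
      · intro i hi
        obtain ⟨b', hb'⟩ := hc i (by omega)
        refine ⟨b', ?_⟩
        simp only [CoinMachine.moveTo, Finsupp.update_apply, hm]
        rw [if_neg (by simp; omega), hb']
    · rw [hs]; simp [djMachine]
    · rw [hs, hw, hr]
      exact djMachine_perm rfl

/-- The Hadamard transforms of both bits have amplitude `1 / √2` at `false`, and only this component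
stays in state `3`. The sign for `c = true` sits on the component sent to state `4`. -/
theorem stepL_back (x u : List Bool) {n : ℕ} (hn : u.length < n) (b c : Bool) :
    stepL B (Finsupp.single (conf 3 x x.length (backTape n (u ++ [c]) b)) 1) -
      amp • Finsupp.single (conf 3 x x.length (backTape n u b)) 1 ∈ bad u.length := by
  classical
  have hr : (backTape n (u ++ [c]) b).read = .bit c := by
    simp only [Tape.read, backTape, Finsupp.update_apply, List.length_append, List.length_singleton]
    rw [if_neg (by push_cast; omega)]
    push_cast
    rw [add_sub_cancel_right]
    exact Tape.cells_ofWord_append_cons u [] c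
  have hm3 : CoinMachine.moveTo (conf 3 x x.length (backTape n (u ++ [c]) b)) (3 : Fin 5) .blank =
      conf 3 x x.length (backTape n u b) := by
    refine Frame.Cfg.ext rfl
      (Tape.ext rfl (by simp [conf, CoinMachine.moveTo, djMachine, Move.shift])) (Tape.ext ?_
        (by simp [conf, CoinMachine.moveTo, djMachine, Move.shift, backTape, sub_eq_add_neg]))
    simp only [conf, CoinMachine.moveTo, backTape]
    rw [← Tape.update_ofWord_snoc_blank u c]
    ext i
    simp only [Finsupp.update_apply, List.length_append, List.length_singleton]
    push_cast
    rw [add_sub_cancel_right]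
    split_ifs <;> first | rfl | omega
  have hm4 : ∀ z : ℂ, Finsupp.single (CoinMachine.moveTo
      (conf 3 x x.length (backTape n (u ++ [c]) b)) (4 : Fin 5) .blank) z ∈ bad u.length := by
    intro z
    refine Finsupp.single_mem_supported _ _ ⟨rfl, ?_, ?_, ?_⟩
    · have := Tape.read_ofWord_of_le (s := 1) x le_rfl
      simpa [CoinMachine.moveTo, djMachine, Move.shift, conf] using this
    · simp [CoinMachine.moveTo, djMachine, Move.shift, conf, backTape, sub_eq_add_neg]
    · intro i hi
      refine ⟨u[i], ?_⟩
      simp only [CoinMachine.moveTo, conf, backTape, Finsupp.update_apply, List.length_append,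
        List.length_singleton]
      rw [if_neg (by push_cast; omega), if_neg (by omega),
        Tape.cells_ofWord_snoc_of_ne _ _ (by omega),
        Tape.cells_ofWord_natCast]
      simp [List.getD_eq_getElem?_getD, hi]
  have hcoin : djMachine.coin (conf 3 x x.length (backTape n (u ++ [c]) b)).state
      (conf 3 x x.length (backTape n (u ++ [c]) b)).work.read = true := by
    simp [conf, djMachine]
  have hr' : (conf 3 x x.length (backTape n (u ++ [c]) b)).query.read = .bit c := hr
  cases c
  · rw [CoinMachine.stepLinear_single_coin (callOracle_eq B rfl) hcoin
      (q₁ := (3 : Fin 5)) (b₁ := .blank) (q₂ := (4 : Fin 5)) (b₂ := .blank)]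
    · rw [hm3, hr']
      have := hm4 amp
      simpa [Sym.isOne] using this
    · simp only [conf, Tape.read_ofWord_of_le _ le_rfl, hr]
      exact djMachine_perm rfl
    · simp only [conf, Tape.read_ofWord_of_le _ le_rfl, hr]
      exact djMachine_perm rfl
  · rw [CoinMachine.stepLinear_single_coin (callOracle_eq B rfl) hcoin
      (q₁ := (4 : Fin 5)) (b₁ := .blank) (q₂ := (3 : Fin 5)) (b₂ := .blank)]
    · rw [hm3, hr']
      have := hm4 (-amp)
      simpa [Sym.isOne] using this
    · simp only [conf, Tape.read_ofWord_of_le _ le_rfl, hr]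
      exact djMachine_perm rfl
    · simp only [conf, Tape.read_ofWord_of_le _ le_rfl, hr]
      exact djMachine_perm rfl

/-- The vector `|u⟩ (|0⟩ - |1⟩)` in state `3`. -/
def backVec (x : List Bool) (u : List Bool) : djMachine.frame.Cfg →₀ ℂ :=
  Finsupp.single (conf 3 x x.length (backTape x.length u false)) 1 -
    Finsupp.single (conf 3 x x.length (backTape x.length u true)) 1

theorem stepL_backVec (x u : List Bool) (hn : u.length < x.length) (c : Bool) :
    stepL B (backVec x (u ++ [c])) - amp • backVec x u ∈ bad u.length := by
  have h := sub_mem (stepL_back B x u hn false c) (stepL_back B x u hn true c)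
  convert h using 1
  simp only [backVec, map_sub, smul_sub]
  abel

theorem run_eq_iterate (T : ℕ) (x : List Bool) : djMachine.toPreQTM.run B T x =
    (stepL B)^[T] (Finsupp.single (conf 0 x 0 ⟨(Tape.ofWord []).cells, 0⟩) 1) := by
  rw [← init_eq]; rfl

theorem run_spread (x : List Bool) (k : ℕ) (hk : k ≤ x.length) :
    djMachine.toPreQTM.run B k x = amp ^ k • ∑ u ∈ words k,
      Finsupp.single (conf 0 x k ⟨(Tape.ofWord u).cells, k⟩) 1 := by
  induction k with
  | zero => rw [run_eq_iterate, sum_words_zero]; simp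
  | succ k ih =>
    rw [PreQTM.run_succ, ih (by omega), ← PreQTM.stepLinear_apply, map_smul, map_sum,
      sum_words_snoc, pow_succ, mul_smul, Finset.smul_sum (r := amp)]
    congr 1
    refine Finset.sum_congr rfl fun u hu => ?_
    obtain ⟨pre, a, rest, rfl, rfl⟩ : ∃ pre a rest, x = pre ++ a :: rest ∧ k = pre.length :=
      ⟨x.take k, x[k], x.drop (k + 1), by simp, by simp; omega⟩
    have := stepL_zero B pre rest u a
    rw [mem_words] at hu
    rw [hu] at this
    simpa using this

theorem run_query (x : List Bool) : djMachine.toPreQTM.run B (x.length + 3) x =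
    amp ^ (x.length + 1) • ∑ u ∈ words x.length, phase B u • backVec x u := by
  rw [PreQTM.run_succ, PreQTM.run_succ, PreQTM.run_succ, run_spread B x _ le_rfl,
    ← PreQTM.stepLinear_apply, ← PreQTM.stepLinear_apply, ← PreQTM.stepLinear_apply]
  simp only [map_smul, map_sum, pow_succ, mul_smul, Finset.smul_sum (r := amp)]
  congr 1
  refine Finset.sum_congr rfl fun u hu => ?_
  rw [mem_words] at hu
  have h1 := stepL_stepL_end B x u
  have h2 := stepL_query B x u
  rw [hu] at h1 h2
  erw [h1]
  rw [map_smul]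
  erw [h2]
  rfl

/-- Each step back merges `u ++ [false]` and `u ++ [true]` into `u`, adding their coefficients with
a factor `amp`. Only the total sum of the coefficients survives in state `3`. -/
theorem run_back (x : List Bool) (f : List Bool → ℂ) (k : ℕ) (hk : k ≤ x.length) :
    (stepL B)^[k] (∑ u ∈ words k, f u • backVec x u) -
      (amp ^ k * ∑ u ∈ words k, f u) • backVec x [] ∈ bad 0 := by
  have hbad : ∀ k φ, φ ∈ bad k → (stepL B)^[k] φ ∈ bad 0 := by
    intro k
    induction k with
    | zero => exact fun φ h => h
    | succ k ih => exact fun φ h => ih _ (stepL_bad B h)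
  induction k generalizing f with
  | zero => simp [sum_words_zero]
  | succ k ih =>
    have h1 : stepL B (∑ u ∈ words (k + 1), f u • backVec x u) -
        ∑ u ∈ words k, (amp * (f (u ++ [false]) + f (u ++ [true]))) • backVec x u ∈ bad k := by
      rw [sum_words_snoc, map_sum, ← Finset.sum_sub_distrib]
      refine Submodule.sum_mem _ fun u hu => ?_
      rw [mem_words] at hu
      have e := fun c => stepL_backVec B x u (by omega) c
      rw [hu] at e
      have := add_mem (Submodule.smul_mem _ (f (u ++ [false])) (e false))
        (Submodule.smul_mem _ (f (u ++ [true])) (e true))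
      convert this using 1
      simp only [map_add, map_smul]
      module
    have h2 := hbad k _ h1
    have h3 := ih (fun u => amp * (f (u ++ [false]) + f (u ++ [true]))) (by omega)
    rw [Function.iterate_succ_apply]
    have hl : ∀ φ ψ, (stepL B)^[k] (φ - ψ) = (stepL B)^[k] φ - (stepL B)^[k] ψ := fun φ ψ => by
      simp only [← Module.End.pow_apply, map_sub]
    rw [hl] at h2
    have := add_mem h2 h3
    rw [sub_add_sub_cancel, ← Finset.mul_sum, ← mul_assoc, ← pow_succ, ← sum_words_snoc] at this
    exact this

theorem run_final (x : List Bool) : djMachine.toPreQTM.run B (2 * x.length + 3) x -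
    (amp ^ (2 * x.length + 1) * ∑ u ∈ words x.length, phase B u) • backVec x [] ∈ bad 0 := by
  have h := Submodule.smul_mem _ (amp ^ (x.length + 1))
    (run_back B x (phase B) x.length le_rfl)
  convert h using 1
  rw [smul_sub, smul_smul]
  congr 1
  · rw [show 2 * x.length + 3 = x.length + (x.length + 3) by ring, PreQTM.run,
      Function.iterate_add_apply]
    have := run_query B x
    rw [PreQTM.run] at this
    rw [this]
    have e : ∀ (z : ℂ) φ, (stepL B)^[x.length] (z • φ) = z • (stepL B)^[x.length] φ :=
      fun z φ => by simp only [← Module.End.pow_apply, map_smul]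
    exact e _ _
  · congr 1; ring

theorem prob_true (x : List Bool) : djMachine.toQTM.prob B (2 * x.length + 3) true x =
    ‖∑ u ∈ words x.length, phase B u‖ ^ 2 / 2 ^ (2 * x.length) := by
  classical
  refine (PreQTM.prob_eq_weight djMachine.toPreQTM _ _ _ _).trans ?_
  set α := amp ^ (2 * x.length + 1) * ∑ u ∈ words x.length, phase B u with hα
  have hrun : djMachine.toPreQTM.run B (2 * x.length + 3) x = α • backVec x [] +
    (djMachine.toPreQTM.run B (2 * x.length + 3) x - α • backVec x []) := by
      rw [add_sub_cancel]
  have hbad := run_final B x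
  rw [← hα] at hbad
  rw [hrun, weight_add_of_eq_zero]
  · set c₀ := conf 3 x x.length (backTape x.length [] false) with hc₀
    set c₁ := conf 3 x x.length (backTape x.length [] true) with hc₁
    have hne : c₀ ≠ c₁ := by
      intro h
      have := congrArg (fun c => c.query.cells x.length) h
      simp [hc₀, hc₁, conf, backTape, Finsupp.update_apply] at this
    have hη : α • backVec x [] = Finsupp.single c₀ α + Finsupp.single c₁ (-α) := by
      simp [backVec, ← hc₀, ← hc₁, sub_eq_add_neg]
    -- The two target values contribute equally; this factor 2 cancels one of the `2 * x.length + 1`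
    -- halvings.
    rw [hη, weight_eq_sum _ _ {c₀, c₁}]
    · have hg : ∀ b, djMachine.output (conf 3 x x.length (backTape x.length [] b)).state =
          some true := fun b => rfl
      rw [Finset.sum_pair hne, if_pos (hg false), if_pos (hg true)]
      simp only [Finsupp.add_apply, Finsupp.single_apply, hne, hne.symm, if_true, if_false,
        add_zero, zero_add, norm_neg, one_mul]
      rw [hα, norm_mul, norm_pow, norm_inv, Complex.norm_real, Real.norm_eq_abs,
        abs_of_nonneg (Real.sqrt_nonneg 2), mul_pow, ← pow_mul, mul_comm (2 * x.length + 1) 2,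
        pow_mul, inv_pow, Real.sq_sqrt (by norm_num), pow_succ, inv_pow]
      ring
    · refine Finsupp.support_add.trans (Finset.union_subset ?_ ?_)
      · exact Finsupp.support_single_subset.trans (by simp)
      · exact Finsupp.support_single_subset.trans (by simp)
  · intro c hc
    have := (Finsupp.mem_supported _ _).1 hbad (Finsupp.mem_support_iff.2 hc)
    have hs : djMachine.output c.state = some false := by
      rw [show c.state = (4 : Fin 5) from this.1]; rfl
    simp [hs]

end djMachine

/-- The language `B` contains all or none of the words of length `n`. -/
def ConstantAt (B : Language Bool) (n : ℕ) : Prop :=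
  (∀ w ∈ words n, w ∈ B) ∨ ∀ w ∈ words n, w ∉ B

/-- The language `B` contains exactly half of the words of length `n`. -/
def BalancedAt (B : Language Bool) (n : ℕ) : Prop :=
  open Classical in 2 * ((words n).filter fun w => w ∈ B).card = 2 ^ n

theorem sum_phase_of_balancedAt {B : Language Bool} {n : ℕ} (h : BalancedAt B n) :
    ∑ u ∈ words n, djMachine.phase B u = 0 := by
  classical
  have h1 : ∀ u, djMachine.phase B u = 1 - 2 * (if u ∈ B then 1 else 0) := fun u => by
    unfold djMachine.phase; split_ifs <;> norm_num
  simp only [h1, Finset.sum_sub_distrib, ← Finset.mul_sum, Finset.sum_boole, Finset.sum_const,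
    card_words, nsmul_eq_mul, mul_one]
  rw [sub_eq_zero]
  have : ((2 * ((words n).filter fun w => w ∈ B).card : ℕ) : ℂ) = ((2 ^ n : ℕ) : ℂ) := by
    rw [← h]
  push_cast at this ⊢
  exact this.symm

theorem norm_sum_phase_of_constantAt {B : Language Bool} {n : ℕ} (h : ConstantAt B n) :
    ‖∑ u ∈ words n, djMachine.phase B u‖ = 2 ^ n := by
  rcases h with h | h
  · rw [Finset.sum_congr rfl fun u hu => by rw [djMachine.phase, if_pos (h u hu)]]
    simp
  · rw [Finset.sum_congr rfl fun u hu => by rw [djMachine.phase, if_neg (h u hu)]]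
    simp

theorem constantAt_mem_EQP {B : Language Bool} (hB : ∀ n, ConstantAt B n ∨ BalancedAt B n) :
    ({x | ConstantAt B x.length} : Language Bool) ∈ EQP B := by
  refine ⟨djMachine.toQTM, 2 * Polynomial.X + 3, fun x => ?_⟩
  have e : (2 * Polynomial.X + 3 : Polynomial ℕ).eval x.length = 2 * x.length + 3 := by simp
  simp only [e]
  constructor
  · intro hx
    have hx : ConstantAt B x.length := hx
    rw [djMachine.prob_true, norm_sum_phase_of_constantAt hx, ← pow_mul, mul_comm]
    field_simp
  · intro hx
    have hx := (hB x.length).resolve_left hx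
    have h1 := djMachine.toQTM.prob_add_prob_eq B (2 * x.length + 3) x
      fun q => Option.some_ne_none _
    rw [djMachine.prob_true, sum_phase_of_balancedAt hx] at h1
    simpa using h1

/-! ### The polynomial method -/

section LowDegree

open Classical in
/-- The monomial with the variables `U`, as a function of the oracle, with coefficient `v`. -/
def monomial {V : Type*} [Zero V] (U : Finset (List Bool)) (v : V) (A : Language Bool) : V :=
  if ∀ u ∈ U, u ∈ A then v else 0

/-- The functions of the oracle that are polynomials of degree at most `d`. -/
def lowDegree (V : Type*) [AddCommGroup V] [Module ℂ V] (d : ℕ) :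
    Submodule ℂ (Language Bool → V) :=
  Submodule.span ℂ {F | ∃ U : Finset (List Bool), U.card ≤ d ∧ ∃ v, F = monomial U v}

variable {V W : Type*} [AddCommGroup V] [Module ℂ V] [AddCommGroup W] [Module ℂ W] {d : ℕ}

theorem monomial_mem_lowDegree {U : Finset (List Bool)} (hU : U.card ≤ d) (v : V) :
    monomial U v ∈ lowDegree V d :=
  Submodule.subset_span ⟨U, hU, v, rfl⟩

theorem comp_mem_lowDegree (f : V →ₗ[ℂ] W) {F : Language Bool → V} (hF : F ∈ lowDegree V d) :
    (fun A => f (F A)) ∈ lowDegree W d := by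
  induction hF using Submodule.span_induction with
  | zero => simp only [Pi.zero_apply, map_zero]; exact zero_mem _
  | add F G _ _ h1 h2 => simp only [Pi.add_apply, map_add]; exact add_mem h1 h2
  | smul a F _ h => simp only [Pi.smul_apply, map_smul]; exact Submodule.smul_mem _ a h
  | mem F h =>
    obtain ⟨U, hU, v, rfl⟩ := h
    convert monomial_mem_lowDegree hU (f v) using 2 with A
    simp only [monomial]
    split_ifs <;> simp

/-- The span consists of finite combinations, so only finitely many variables occur. This is what
makes the failure of a machine an open condition on the oracle. -/
theorem exists_finset_of_mem_lowDegree {F : Language Bool → V} (hF : F ∈ lowDegree V d) :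
    ∃ S : Finset (List Bool), ∀ A A' : Language Bool, (∀ u ∈ S, u ∈ A ↔ u ∈ A') → F A = F A' := by
  classical
  induction hF using Submodule.span_induction with
  | zero => exact ⟨∅, fun _ _ _ => rfl⟩
  | add F G _ _ h1 h2 =>
    obtain ⟨S, hS⟩ := h1
    obtain ⟨S', hS'⟩ := h2
    refine ⟨S ∪ S', fun A A' h => ?_⟩
    rw [Pi.add_apply, Pi.add_apply, hS A A' fun u hu => h u (Finset.mem_union_left _ hu),
      hS' A A' fun u hu => h u (Finset.mem_union_right _ hu)]
  | smul a F _ h =>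
    obtain ⟨S, hS⟩ := h
    exact ⟨S, fun A A' h => by rw [Pi.smul_apply, Pi.smul_apply, hS A A' h]⟩
  | mem F h =>
    obtain ⟨U, hU, v, rfl⟩ := h
    refine ⟨U, fun A A' h => ?_⟩
    have : (∀ u ∈ U, u ∈ A) ↔ ∀ u ∈ U, u ∈ A' := forall₂_congr h
    simp only [monomial, this]

/-- Flip the membership of the words in `W`. -/
def flip (B : Language Bool) (W : Finset (List Bool)) : Language Bool :=
  {u | (u ∈ B ∧ u ∉ W) ∨ (u ∉ B ∧ u ∈ W)}

theorem mem_flip {B : Language Bool} {W : Finset (List Bool)} {u : List Bool} :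
    u ∈ flip B W ↔ (u ∈ B ∧ u ∉ W) ∨ (u ∉ B ∧ u ∈ W) := Iff.rfl

/-- Finite differences of high order annihilate polynomials of low degree. -/
theorem sum_powerset_flip_eq_zero {F : Language Bool → V} (hF : F ∈ lowDegree V d)
    (B : Language Bool) {W : Finset (List Bool)} (hW : d < W.card) :
    ∑ X ∈ W.powerset, (-1 : ℂ) ^ X.card • F (flip B X) = 0 := by
  classical
  induction hF using Submodule.span_induction with
  | zero => simp
  | add F G _ _ h1 h2 =>
    simp only [Pi.add_apply, smul_add, Finset.sum_add_distrib, h1, h2, add_zero]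
  | smul a F _ h =>
    simp only [Pi.smul_apply, smul_comm _ a, ← Finset.smul_sum, h, smul_zero]
  | mem F h =>
    obtain ⟨U, hU, v, rfl⟩ := h
    -- The monomial does not involve `w`, so the terms for `X` and `insert w X` cancel.
    obtain ⟨w, hw, hwU⟩ := Finset.exists_mem_notMem_of_card_lt_card (hU.trans_lt hW)
    rw [← Finset.insert_erase hw, Finset.sum_powerset_insert (Finset.notMem_erase w W),
      ← Finset.sum_add_distrib]
    refine Finset.sum_eq_zero fun X hX => ?_
    have hwX : w ∉ X := fun h => Finset.notMem_erase w W (Finset.mem_powerset.1 hX h)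
    have : (∀ u ∈ U, u ∈ flip B (insert w X)) ↔ ∀ u ∈ U, u ∈ flip B X := by
      refine forall₂_congr fun u hu => ?_
      have : u ≠ w := fun h => hwU (h ▸ hu)
      simp [mem_flip, this]
    rw [Finset.card_insert_of_notMem hwX, monomial, monomial, pow_succ]
    simp only [this]
    split_ifs <;> simp

/-- A polynomial of degree at most `d` that vanishes at all points of a cube at distance at most
`d` from a corner vanishes on the whole cube. -/
theorem eq_zero_of_lowDegree {F : Language Bool → V} (hF : F ∈ lowDegree V d)
    {B : Language Bool} {K : Finset (List Bool)}
    (h : ∀ W ⊆ K, W.card ≤ d → F (flip B W) = 0) : ∀ W ⊆ K, F (flip B W) = 0 := by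
  intro W
  induction W using Finset.strongInduction with
  | H W ih =>
    intro hWK
    by_cases hd : W.card ≤ d
    · exact h W hWK hd
    · have := sum_powerset_flip_eq_zero hF B (not_le.1 hd)
      -- In the vanishing difference over `W`, all terms from proper subsets are zero by induction.
      rw [Finset.sum_eq_single W] at this
      · simpa using this
      · intro X hX hne
        rw [Finset.mem_powerset] at hX
        rw [ih X (hX.ssubset_of_ne hne) (hX.trans hWK), smul_zero]
      · simp

end LowDegree

/-! ### Amplitudes as polynomials in the oracle. -/

theorem Frame.Cfg.callOracle_congr {F : Frame} (c : F.Cfg) {A A' : Language Bool}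
    (h : c.query.queryWord ∈ A ↔ c.query.queryWord ∈ A') : c.callOracle A = c.callOracle A' := by
  simp only [Frame.Cfg.callOracle, Tape.callOracle]
  rw [decide_eq_decide.2 h]

namespace PreQTM

variable (M : PreQTM)

/-- On one configuration the call depends on the oracle only through the bit of its query word `w`.
The result is affine in that bit, so a monomial acquires at most one new variable. -/
theorem stepLinear_mem_lowDegree {d : ℕ} {F : Language Bool → (M.Cfg →₀ ℂ)}
    (hF : F ∈ lowDegree _ d) : (fun A => M.stepLinear A (F A)) ∈ lowDegree _ (d + 1) := by
  classical
  induction hF using Submodule.span_induction with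
  | zero => simp only [Pi.zero_apply, map_zero]; exact zero_mem _
  | add F G _ _ h1 h2 => simp only [Pi.add_apply, map_add]; exact add_mem h1 h2
  | smul a F _ h => simp only [Pi.smul_apply, map_smul]; exact Submodule.smul_mem _ a h
  | mem F h =>
    obtain ⟨U, hU, ψ, rfl⟩ := h
    induction ψ using Finsupp.induction_linear with
    | zero =>
      convert zero_mem (lowDegree (M.Cfg →₀ ℂ) (d + 1)) using 2 with A
      simp [monomial]
    | add φ ψ h1 h2 =>
      convert add_mem h1 h2 using 2 with A
      simp only [monomial, Pi.add_apply]
      split_ifs <;> simp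
    | single c z =>
      set w := c.query.queryWord
      obtain ⟨c₀, c₁, hc₀, hc₁⟩ : ∃ c₀ c₁ : M.Cfg,
          (∀ A : Language Bool, w ∉ A → c.callOracle A = c₀) ∧
            ∀ A : Language Bool, w ∈ A → c.callOracle A = c₁ := by
        exact ⟨c.callOracle (fun _ => False), c.callOracle (fun _ => True),
          fun A hA => c.callOracle_congr (iff_of_false hA fun h => h),
          fun A hA => c.callOracle_congr (iff_of_true hA trivial)⟩
      have key : (fun A => M.stepLinear A (monomial U (Finsupp.single c z) A)) =
          monomial U (z • M.succ c₀) + monomial (insert w U) (z • M.succ c₁ - z • M.succ c₀) := by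
        funext A
        have hs : M.stepLinear A (Finsupp.single c z) = z • M.succ (c.callOracle A) := by
          rw [← M.stepLinear_single, ← map_smul, Finsupp.smul_single_one]
        simp only [monomial, Pi.add_apply, Finset.forall_mem_insert]
        by_cases hU : ∀ u ∈ U, u ∈ A
        · by_cases hA : w ∈ A
          · simp only [if_pos hU, hs, hc₁ A hA]
            rw [if_pos ⟨hA, hU⟩, add_sub_cancel]
          · simp only [if_pos hU, hs, hc₀ A hA]
            rw [if_neg fun h => hA h.1, add_zero]
        · simp [hU]
      rw [key]
      exact add_mem (monomial_mem_lowDegree (by omega) _)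
        (monomial_mem_lowDegree ((Finset.card_insert_le _ _).trans (by omega)) _)

/-- The superposition after `T` steps is a polynomial of degree at most `T` in the oracle. -/
theorem run_mem_lowDegree (T : ℕ) (x : List Bool) :
    (fun A => M.run A T x) ∈ lowDegree (M.Cfg →₀ ℂ) T := by
  induction T with
  | zero =>
    convert monomial_mem_lowDegree (d := 0) (U := ∅) (by simp) (Finsupp.single (M.init x) (1 : ℂ))
      using 2 with A
    simp [run, monomial]
  | succ T ih =>
    simp only [run_succ]
    exact M.stepLinear_mem_lowDegree ih

/-- Turns vanishing acceptance probability into vanishing of single amplitudes, to which the degree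
bound applies. -/
theorem prob_eq_zero_iff (A : Language Bool) (T : ℕ) (b : Bool) (x : List Bool) :
    M.prob A T b x = 0 ↔ ∀ c : M.Cfg, M.output c.state = some b → M.run A T x c = 0 := by
  rw [prob_eq_weight, weight, Finsupp.sum, Finset.sum_eq_zero_iff_of_nonneg]
  · refine ⟨fun h c hc => ?_, fun h c _ => ?_⟩
    · by_contra hne
      have := h c (Finsupp.mem_support_iff.2 hne)
      simp [hc] at this
      exact hne this
    · by_cases hc : M.output c.state = some b
      · simp [h c hc]
      · simp [hc]
  · intro c _
    split_ifs <;> positivity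

end PreQTM

/-! ### Oracles that encode constant or balanced functions -/

theorem length_interleave {w j : List Bool} (h : j.length = w.length) :
    (interleave w j).length = 2 * w.length := by
  induction w generalizing j with
  | nil => simp [interleave]
  | cons a w ih =>
    obtain _ | ⟨r, j⟩ := j
    · simp at h
    · simp only [interleave, List.length_cons, ih (by simpa using h)]
      ring

theorem interleave_injOn (w : List Bool) :
    Set.InjOn (interleave w) {j | j.length = w.length} := by
  induction w with
  | nil => intro j hj j' hj' _; simp_all
  | cons a w ih =>
    rintro (_ | ⟨r, j⟩) hj (_ | ⟨r', j'⟩) hj' h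
    · rfl
    · simp at hj
    · simp at hj'
    · simp only [interleave, List.cons.injEq, true_and] at h
      simp only [Set.mem_ofPred_eq, List.length_cons, Nat.add_right_cancel_iff] at hj hj'
      rw [h.1, ih hj hj' h.2]

/-- The letters at even positions, without a last letter that has no partner. -/
def evens : List Bool → List Bool
  | a :: _ :: l => a :: evens l
  | _ => []

theorem evens_interleave {w j : List Bool} (h : j.length = w.length) :
    evens (interleave w j) = w := by
  induction w generalizing j with
  | nil => simp [interleave, evens]
  | cons a w ih =>
    obtain _ | ⟨r, j⟩ := j
    · simp at h
    · simp only [interleave, evens, ih (by simpa using h)]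

theorem evens_interleave_snoc {w j : List Bool} (h : j.length = w.length) (b : Bool) :
    evens (interleave w j ++ [b]) = w := by
  induction w generalizing j with
  | nil => simp [interleave, evens]
  | cons a w ih =>
    obtain _ | ⟨r, j⟩ := j
    · simp at h
    · simp only [interleave, List.cons_append, evens, ih (by simpa using h)]

theorem length_evens : ∀ u : List Bool, (evens u).length = u.length / 2
  | [] => rfl
  | [_] => by simp [evens]
  | _ :: _ :: l => by simp only [evens, List.length_cons, length_evens l]; omega

/-- The oracles `A` and `A'` agree on the blocks of the words of length `n`. -/
def AgreeAt (n : ℕ) (A A' : Language Bool) : Prop := ∀ u, u.length / 2 = n → (u ∈ A ↔ u ∈ A')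

theorem AgreeAt.symm {n : ℕ} {A A' : Language Bool} (h : AgreeAt n A A') : AgreeAt n A' A :=
  fun u hu => (h u hu).symm

theorem AgreeAt.blockOne_iff {n : ℕ} {A A' : Language Bool} (h : AgreeAt n A A') {w : List Bool}
    (hw : w ∈ words n) : BlockOne A w ↔ BlockOne A' w := by
  classical
  rw [mem_words] at hw
  have h0 : ∀ j ∈ words w.length, interleave w j ∈ A ↔ interleave w j ∈ A' := fun j hj =>
    h _ (by rw [length_interleave (mem_words.1 hj)]; omega)
  have h1 : ∀ j ∈ words w.length, interleave w j ++ [false] ∈ A ↔ interleave w j ++ [false] ∈ A' :=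
    fun j hj => h _ (by simp [length_interleave (mem_words.1 hj)]; omega)
  unfold BlockOne
  rw [Finset.filter_congr h1, forall₂_congr fun j hj => not_congr (h0 j hj)]

theorem AgreeAt.blockZero_iff {n : ℕ} {A A' : Language Bool} (h : AgreeAt n A A') {w : List Bool}
    (hw : w ∈ words n) : BlockZero A w ↔ BlockZero A' w := by
  classical
  rw [mem_words] at hw
  have h0 : ∀ j ∈ words w.length, interleave w j ∈ A ↔ interleave w j ∈ A' := fun j hj =>
    h _ (by rw [length_interleave (mem_words.1 hj)]; omega)
  have h1 : ∀ j ∈ words w.length, interleave w j ++ [false] ∈ A ↔ interleave w j ++ [false] ∈ A' :=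
    fun j hj => h _ (by simp [length_interleave (mem_words.1 hj)]; omega)
  unfold BlockZero
  rw [Finset.filter_congr h0, forall₂_congr fun j hj => not_congr (h1 j hj)]

theorem AgreeAt.constantAt_iff {n : ℕ} {A A' : Language Bool} (h : AgreeAt n A A') :
    ConstantAt (decoded A) n ↔ ConstantAt (decoded A') n :=
  or_congr (forall₂_congr fun _ hw => h.blockOne_iff hw)
    (forall₂_congr fun _ hw => not_congr (h.blockOne_iff hw))

theorem AgreeAt.balancedAt_iff {n : ℕ} {A A' : Language Bool} (h : AgreeAt n A A') :
    BalancedAt (decoded A) n ↔ BalancedAt (decoded A') n := by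
  classical
  unfold BalancedAt
  rw [Finset.filter_congr fun w hw => show w ∈ decoded A ↔ w ∈ decoded A' from h.blockOne_iff hw]

theorem not_blockOne_of_blockZero {A : Language Bool} {w : List Bool} (h : BlockZero A w) :
    ¬ BlockOne A w := by
  classical
  intro h'
  have h1 := h.1
  rw [Finset.filter_false_of_mem fun j hj => h'.2 j hj] at h1
  simp at h1

theorem not_constantAt_of_balancedAt {B : Language Bool} {n : ℕ} (h : BalancedAt B n) :
    ¬ ConstantAt B n := by
  classical
  unfold BalancedAt at h
  have : 0 < 2 ^ n := by positivity
  rintro (h' | h')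
  · rw [Finset.filter_true_of_mem h', card_words] at h
    omega
  · rw [Finset.filter_false_of_mem h', Finset.card_empty] at h
    omega

/-- The blocks of the words of length `n` encode a function that is constant or balanced. -/
def PromiseAt (n : ℕ) (A : Language Bool) : Prop :=
  (∀ w ∈ words n, BlockZero A w ∨ BlockOne A w) ∧
    (ConstantAt (decoded A) n ∨ BalancedAt (decoded A) n)

theorem AgreeAt.promiseAt {n : ℕ} {A A' : Language Bool} (h : AgreeAt n A A')
    (hA : PromiseAt n A) : PromiseAt n A' :=
  ⟨fun w hw => by rw [← h.blockZero_iff hw, ← h.blockOne_iff hw]; exact hA.1 w hw,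
    by rw [← h.constantAt_iff, ← h.balancedAt_iff]; exact hA.2⟩

/-- The words in the blocks of the words of length `n` that may belong to an oracle for which `Z`
is the set of the words whose block encodes `0`. -/
def pattern (n : ℕ) (Z : Finset (List Bool)) : Finset (List Bool) :=
  ((words (2 * n)).filter fun u => evens u ∈ Z) ∪ (words (2 * n + 1)).filter fun u => evens u ∉ Z

theorem mem_pattern {n : ℕ} {Z : Finset (List Bool)} {u : List Bool} :
    u ∈ pattern n Z ↔ (u.length = 2 * n ∧ evens u ∈ Z) ∨ (u.length = 2 * n + 1 ∧ evens u ∉ Z) := by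
  simp [pattern]

theorem card_filter_not_mem_le {n d : ℕ} {W : Finset (List Bool)} (hW : W.card ≤ d)
    (hd : 2 * d ≤ 2 ^ n) {f : List Bool → List Bool} (hf : Set.InjOn f {j | j.length = n})
    {A : Language Bool} (hA : ∀ j ∈ words n, f j ∉ W → f j ∈ A) :
    open Classical in 2 ^ n ≤ 2 * ((words n).filter fun j => f j ∈ A).card := by
  classical
  have h1 : ((words n).filter fun j => f j ∈ W).card ≤ W.card :=
    Finset.card_le_card_of_injOn f (fun j hj => by simp_all)
      (hf.mono fun j hj => by simp_all)
  have h2 : ((words n).filter fun j => f j ∉ W).card ≤ ((words n).filter fun j => f j ∈ A).card :=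
    Finset.card_le_card fun j hj => by
      rw [Finset.mem_filter] at hj ⊢
      exact ⟨hj.1, hA j hj.1 hj.2⟩
  have h3 := Finset.card_filter_add_card_filter_not (s := words n) (fun j => f j ∈ W)
  rw [card_words] at h3
  omega

/-- The full pattern has all `2 ^ n` admissible words in each block. Removing at most `d` words
leaves at least half of them and puts nothing into the forbidden halves, so no block changes its
value. -/
theorem balanced_of_pattern {n d : ℕ} (hd : 2 * d ≤ 2 ^ n) {Z W : Finset (List Bool)}
    (hZ : Z ⊆ words n) (hZc : 2 * Z.card = 2 ^ n) (hW : W.card ≤ d) {A : Language Bool}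
    (hA : ∀ u, u.length / 2 = n → (u ∈ A ↔ u ∈ pattern n Z ∧ u ∉ W)) :
    (∀ w ∈ words n, BlockZero A w ∨ BlockOne A w) ∧ BalancedAt (decoded A) n := by
  classical
  have even : ∀ w ∈ words n, ∀ j ∈ words n,
      (interleave w j ∈ A ↔ w ∈ Z ∧ interleave w j ∉ W) := by
    intro w hw j hj
    rw [mem_words] at hw hj
    have hl := length_interleave (hj.trans hw.symm)
    rw [hA _ (by omega), mem_pattern, evens_interleave (hj.trans hw.symm), hl, hw]
    simp
  have odd : ∀ w ∈ words n, ∀ j ∈ words n,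
      (interleave w j ++ [false] ∈ A ↔ w ∉ Z ∧ interleave w j ++ [false] ∉ W) := by
    intro w hw j hj
    rw [mem_words] at hw hj
    have hl := length_interleave (hj.trans hw.symm)
    rw [hA _ (by simp; omega), mem_pattern, evens_interleave_snoc (hj.trans hw.symm),
      List.length_append, hl, hw]
    simp
  have hzero : ∀ w ∈ Z, BlockZero A w := by
    intro w hw
    have hwn := mem_words.1 (hZ hw)
    refine ⟨?_, ?_⟩
    · rw [hwn]
      refine card_filter_not_mem_le hW hd ?_ fun j hj h => (even w (hZ hw) j hj).2 ⟨hw, h⟩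
      rw [← hwn]
      exact interleave_injOn w
    · rw [hwn]
      intro j hj h
      exact ((odd w (hZ hw) j hj).1 h).1 hw
  have hone : ∀ w ∈ words n, w ∉ Z → BlockOne A w := by
    intro w hw hwZ
    have hwn := mem_words.1 hw
    refine ⟨?_, ?_⟩
    · rw [hwn]
      refine card_filter_not_mem_le (f := fun j => interleave w j ++ [false]) hW hd ?_
        fun j hj h => (odd w hw j hj).2 ⟨hwZ, h⟩
      rw [← hwn]
      intro j hj j' hj' h
      exact interleave_injOn w hj hj' (List.append_cancel_right h)
    · rw [hwn]
      intro j hj h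
      exact hwZ ((even w hw j hj).1 h).1
  refine ⟨fun w hw => ?_, ?_⟩
  · by_cases hwZ : w ∈ Z
    · exact Or.inl (hzero w hwZ)
    · exact Or.inr (hone w hw hwZ)
  · unfold BalancedAt
    have : ((words n).filter fun w => w ∈ decoded A) = words n \ Z := by
      ext w
      simp only [Finset.mem_filter, Finset.mem_sdiff]
      refine and_congr_right fun hw => ⟨fun h hwZ => ?_, hone w hw⟩
      exact not_blockOne_of_blockZero (hzero w hwZ) h
    rw [this, Finset.card_sdiff_of_subset hZ, card_words]
    omega

/-- A polynomial of low degree that vanishes on all encodings of balanced functions vanishes on an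
encoding of a constant function. -/
theorem eq_zero_of_eq_zero_on_balanced {V : Type*} [AddCommGroup V] [Module ℂ V]
    {n d : ℕ} (hn : n ≠ 0) (hd : 2 * d ≤ 2 ^ n) {F : Language Bool → V} (hF : F ∈ lowDegree V d)
    {R : Language Bool} (hR : ∀ u ∈ R, u.length / 2 ≠ n)
    (h : ∀ A : Language Bool, (∀ u, u.length / 2 ≠ n → (u ∈ A ↔ u ∈ R)) →
      (∀ w ∈ words n, BlockZero A w ∨ BlockOne A w) → BalancedAt (decoded A) n → F A = 0) :
    F (flip R (words (2 * n))) = 0 := by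
  classical
  have level : ∀ {Z u}, u ∈ pattern n Z → u.length / 2 = n := fun hu => by
    rcases mem_pattern.1 hu with hu | hu <;> omega
  have half : 2 * 2 ^ (n - 1) = 2 ^ n := by
    rw [mul_comm, ← pow_succ, Nat.sub_add_cancel (Nat.one_le_iff_ne_zero.2 hn)]
  -- Outer cube: start from an empty level n and add even-length words. It suffices to treat sets
  -- `W` of at most `d` added words.
  refine eq_zero_of_lowDegree hF (K := words (2 * n)) (fun W hW hWd => ?_) _ subset_rfl
  -- These words touch at most `d ≤ 2 ^ (n - 1)` blocks, so some balanced function is 0 on all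
  -- touched blocks.
  obtain ⟨Z, hWZ, hZ, hZc⟩ := Finset.exists_subsuperset_card_eq (s := W.image evens) (t := words n)
    (n := 2 ^ (n - 1)) (by
      intro w hw
      obtain ⟨u, hu, rfl⟩ := Finset.mem_image.1 hw
      have := mem_words.1 (hW hu)
      rw [mem_words, length_evens, this]
      omega)
    (Finset.card_image_le.trans (by omega)) (by rw [card_words]; omega)
  -- Inner cube: start from the full pattern and remove words. Near this corner all oracles encode
  -- the same balanced function.
  have hpat : ∀ X ⊆ pattern n Z, F (flip (flip R (pattern n Z)) X) = 0 := by
    refine eq_zero_of_lowDegree hF fun X hX hXd => ?_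
    have hbal := balanced_of_pattern (A := flip (flip R (pattern n Z)) X) hd hZ (by omega) hXd
      (fun u hu => by
        have : u ∉ R := fun h => hR u h hu
        have := @hX u
        simp only [mem_flip]
        tauto)
    refine h _ (fun u hu => ?_) hbal.1 hbal.2
    have h1 : u ∉ pattern n Z := fun h => hu (level h)
    have h2 : u ∉ X := fun h => h1 (hX h)
    simp [mem_flip, h1, h2]
  have hWpat : W ⊆ pattern n Z := fun u hu =>
    mem_pattern.2 (Or.inl ⟨mem_words.1 (hW hu), hWZ (Finset.mem_image_of_mem _ hu)⟩)
  -- Removing everything but `W` from the full pattern leaves exactly `W` at level n.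
  convert hpat (pattern n Z \ W) Finset.sdiff_subset using 2
  ext u
  have h1 : u ∈ pattern n Z → u ∉ R := fun h h' => hR u h' (level h)
  have := @hWpat u
  simp only [mem_flip, Finset.mem_sdiff]
  tauto

theorem constantAt_flip {n : ℕ} {R : Language Bool} (hR : ∀ u ∈ R, u.length / 2 ≠ n) :
    (∀ w ∈ words n, BlockZero (flip R (words (2 * n))) w) ∧
      ConstantAt (decoded (flip R (words (2 * n)))) n := by
  classical
  have h : ∀ w ∈ words n, BlockZero (flip R (words (2 * n))) w := by
    intro w hw
    rw [mem_words] at hw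
    constructor
    · rw [Finset.filter_true_of_mem, card_words]
      · omega
      · intro j hj
        have hl := length_interleave (mem_words.1 hj)
        have : interleave w j ∉ R := fun h => hR _ h (by omega)
        rw [mem_flip, mem_words]
        exact Or.inr ⟨this, by omega⟩
    · intro j hj
      have hl := length_interleave (mem_words.1 hj)
      have : interleave w j ++ [false] ∉ R := fun h => hR _ h (by simp; omega)
      rw [mem_flip, mem_words]
      simp [this, hl, hw]
  exact ⟨h, Or.inr fun w hw => not_blockOne_of_blockZero (h w hw)⟩

/-! ### Countability of the quantum machines -/

instance : Countable Frame := by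
  let f : Frame → Σ n : ℕ, ℕ × Fin n × (Fin n → Bool) × (Fin n → Option Bool) :=
    fun F => ⟨F.numStates, F.numMarks, F.start, F.isQuery, F.output⟩
  refine Function.Injective.countable (f := f) ?_
  rintro ⟨n, m, s, q, o⟩ ⟨n', m', s', q', o'⟩ h
  simp only [f, Sigma.mk.injEq] at h
  obtain ⟨rfl, h⟩ := h
  simp_all

instance : Countable {z : ℂ // IsAlgebraic ℚ z} := (Algebraic.countable ℚ ℂ).to_subtype

/-- Algebraicity of the amplitudes is essential here: a machine is a finite table with entries in a
countable field. -/
instance : Countable QTM := by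
  have (F : Frame) : Countable (F.State × F.Symbol × F.Symbol × F.Action →
      {z : ℂ // IsAlgebraic ℚ z}) := inferInstance
  let f : QTM → Σ F : Frame, (F.State × F.Symbol × F.Symbol × F.Action →
      {z : ℂ // IsAlgebraic ℚ z}) :=
    fun M => ⟨M.toFrame, fun k => ⟨M.δ k.1 k.2.1 k.2.2.1 k.2.2.2, M.algebraic _ _ _ _⟩⟩
  refine Function.Injective.countable (f := f) ?_
  rintro ⟨⟨F, δ⟩, h1, h2⟩ ⟨⟨F', δ'⟩, h1', h2'⟩ h
  simp only [f, Sigma.mk.injEq] at h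
  obtain ⟨rfl, h⟩ := h
  have hδ : δ = δ' := by
    funext q a b α
    exact congrArg Subtype.val (congrFun (eq_of_heq h) (q, a, b, α))
  subst hδ
  rfl

instance : Countable (Polynomial ℕ) :=
  Cardinal.mk_le_aleph0_iff.1 (Polynomial.cardinalMk_le_max.trans (by simp))

/-! ### Generic oracles -/

/-- If each of countably many open requirements can be met by changing an oracle with property `P`
at high levels only, then some oracle with property `P` meets all of them. -/
theorem exists_generic {ι : Type*} [Countable ι] {P : ℕ → Language Bool → Prop}
    (hP : ∀ n A A', AgreeAt n A A' → P n A → P n A') {A₀ : Language Bool} (h₀ : ∀ n, P n A₀)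
    {R : ι → Language Bool → Prop}
    (hopen : ∀ i A, R i A → ∃ N, ∀ A', (∀ n < N, AgreeAt n A A') → R i A')
    (hdense : ∀ i A N, (∀ n, P n A) → ∃ A', (∀ n, P n A') ∧ (∀ n < N, AgreeAt n A A') ∧ R i A') :
    ∃ A, (∀ n, P n A) ∧ ∀ i, R i A := by
  cases isEmpty_or_nonempty ι
  · exact ⟨A₀, h₀, isEmptyElim⟩
  obtain ⟨e, he⟩ := exists_surjective_nat ι
  have hstep : ∀ (k : ℕ) (s : {p : Language Bool × ℕ // ∀ n, P n p.1}),
      ∃ s' : {p : Language Bool × ℕ // ∀ n, P n p.1}, s.1.2 < s'.1.2 ∧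
        (∀ n < s.1.2, AgreeAt n s.1.1 s'.1.1) ∧
        ∀ A, (∀ n < s'.1.2, AgreeAt n s'.1.1 A) → R (e k) A := by
    rintro k ⟨⟨A, N⟩, hA⟩
    obtain ⟨A', hA', hag, hR⟩ := hdense (e k) A N hA
    obtain ⟨N', hN'⟩ := hopen _ _ hR
    exact ⟨⟨⟨A', max N' (N + 1)⟩, hA'⟩, by simp, hag,
      fun B hB => hN' B fun n hn => hB n (lt_max_of_lt_left hn)⟩
  choose next hlt hag hR using hstep
  let S : ℕ → {p : Language Bool × ℕ // ∀ n, P n p.1} :=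
    fun k => Nat.rec ⟨⟨A₀, 0⟩, h₀⟩ next k
  have hS : ∀ k, S (k + 1) = next k (S k) := fun _ => rfl
  have hmono : StrictMono fun k => (S k).1.2 :=
    strictMono_nat_of_lt_succ fun k => by rw [hS]; exact hlt k _
  have hagree : ∀ k m, k ≤ m → ∀ n < (S k).1.2, AgreeAt n (S k).1.1 (S m).1.1 := by
    intro k m hkm
    induction m, hkm using Nat.le_induction with
    | base => exact fun n _ u _ => Iff.rfl
    | succ m hkm ih =>
      intro n hn u hu
      rw [ih n hn u hu, hS]
      exact hag m (S m) n (hn.trans_le (hmono.monotone hkm)) u hu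
  -- The limit oracle reads each level at a stage where it no longer changes.
  let A : Language Bool := {u | u ∈ (S (u.length / 2 + 1)).1.1}
  have hA : ∀ k, ∀ n < (S k).1.2, AgreeAt n (S k).1.1 A := by
    intro k n hn u hu
    change u ∈ (S k).1.1 ↔ u ∈ (S (u.length / 2 + 1)).1.1
    rw [hu]
    rcases le_total k (n + 1) with h | h
    · exact hagree k _ h n hn u hu
    · exact (hagree _ k h n (hmono.id_le (n + 1)) u hu).symm
  refine ⟨A, fun n => hP n _ _ (hA (n + 1) n (hmono.id_le (n + 1))) ((S (n + 1)).2 n), fun i => ?_⟩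
  obtain ⟨k, rfl⟩ := he i
  refine hR k (S k) A ?_
  rw [← hS]
  exact hA (k + 1)

/-! ### The separation -/

theorem eventually_mul_eval_le_two_pow (p : Polynomial ℕ) (C : ℕ) :
    ∀ᶠ n : ℕ in Filter.atTop, C * p.eval n ≤ 2 ^ n := by
  induction p using Polynomial.induction_on' generalizing C with
  | add p q hp hq =>
    -- Doubling the constant lets each summand use half of `2 ^ n`.
    filter_upwards [hp (2 * C), hq (2 * C)] with n h1 h2
    rw [Polynomial.eval_add]
    nlinarith
  | monomial k a =>
    have h := isLittleO_pow_const_const_pow_of_one_lt (R := ℝ) k (show (1 : ℝ) < 2 by norm_num)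
    have h1 := h.def (c := (1 : ℝ) / (C * a + 1)) (by positivity)
    filter_upwards [h1] with n hn
    rw [Polynomial.eval_monomial]
    have hn' : (n : ℝ) ^ k * (C * a + 1) ≤ 2 ^ n := by
      rw [Real.norm_of_nonneg (by positivity), Real.norm_of_nonneg (by positivity)] at hn
      rw [one_div_mul_eq_div, le_div_iff₀ (by positivity)] at hn
      exact hn
    have : ((C * (a * n ^ k) : ℕ) : ℝ) ≤ ((2 ^ n : ℕ) : ℝ) := by
      push_cast
      have : (0 : ℝ) ≤ (n : ℝ) ^ k := by positivity
      linarith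
    exact_mod_cast this

/-- The words at whose length the decoded function is constant. -/
def constantLanguage (A : Language Bool) : Language Bool :=
  {x | ConstantAt (decoded A) x.length}

/-- The machine `M` with time bound `p` does not decide `constantLanguage A`. -/
def Fails (i : QTM × Polynomial ℕ) (A : Language Bool) : Prop :=
  ¬ IsNondeterministic (fun b x => i.1.prob A (i.2.eval x.length) b x) (constantLanguage A)

/-- Fix an input `x` on which the machine errs. Its run depends on finitely many oracle words, and
the membership of `x` depends only on the level `x.length`; freezing these levels preserves the
error. -/
theorem Fails.eventually {i : QTM × Polynomial ℕ} {A : Language Bool} (h : Fails i A) :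
    ∃ N, ∀ A', (∀ n < N, AgreeAt n A A') → Fails i A' := by
  obtain ⟨x, hx⟩ := not_forall.1 h
  obtain ⟨S, hS⟩ := exists_finset_of_mem_lowDegree
    (i.1.run_mem_lowDegree (i.2.eval x.length) x)
  refine ⟨max (x.length + 1) (S.sup (fun u => u.length / 2) + 1), fun A' hA' => ?_⟩
  refine not_forall.2 ⟨x, ?_⟩
  have hrun : i.1.run A (i.2.eval x.length) x = i.1.run A' (i.2.eval x.length) x :=
    hS A A' fun u hu => hA' _ (lt_max_of_lt_right (Nat.lt_succ_of_le
      (Finset.le_sup (f := fun u : List Bool => u.length / 2) hu))) u rfl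
  have hL : x ∈ constantLanguage A ↔ x ∈ constantLanguage A' :=
    (hA' x.length (lt_max_of_lt_left (Nat.lt_succ_self _))).constantAt_iff
  rw [← hL]
  simpa only [PreQTM.prob, hrun] using hx

/-- Only a level n, too large for the running time, is rewritten. Either some balanced encoding is
accepted with positive probability, which is an error, or all are rejected, and then the polynomial
method yields a constant encoding with acceptance probability 0. -/
theorem exists_fails (i : QTM × Polynomial ℕ) (A : Language Bool) (N : ℕ)
    (hA : ∀ n, PromiseAt n A) :
    ∃ A', (∀ n, PromiseAt n A') ∧ (∀ n < N, AgreeAt n A A') ∧ Fails i A' := by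
  classical
  obtain ⟨M, p⟩ := i
  -- The factor 2 is the room needed to remove as many words as there are steps and keep half a
  -- block; `n ≥ 1` is needed for balanced functions to exist.
  obtain ⟨n, hn, hN, hn0⟩ := ((eventually_mul_eval_le_two_pow p 2).and
    ((Filter.eventually_ge_atTop N).and (Filter.eventually_ge_atTop 1))).exists
  set x := List.replicate n false with hx
  have hxl : x.length = n := by simp [hx]
  set R : Language Bool := {u | u ∈ A ∧ u.length / 2 ≠ n} with hRdef
  have hR : ∀ u ∈ R, u.length / 2 ≠ n := fun u hu => hu.2
  have hRA : ∀ u, u.length / 2 ≠ n → (u ∈ R ↔ u ∈ A) := fun u hu => and_iff_left hu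
  have promise : ∀ A' : Language Bool, (∀ u, u.length / 2 ≠ n → (u ∈ A' ↔ u ∈ R)) →
      PromiseAt n A' → (∀ m, PromiseAt m A') ∧ ∀ m < N, AgreeAt m A A' := by
    intro A' h hA'
    have hag : ∀ m, m ≠ n → AgreeAt m A A' := fun m hm u hu => by
      rw [h u (by omega), hRA u (by omega)]
    refine ⟨fun m => ?_, fun m hm => hag m (by omega)⟩
    by_cases hm : m = n
    · rw [hm]; exact hA'
    · exact (hag m hm).promiseAt (hA m)
  by_cases hbal : ∃ A' : Language Bool, (∀ u, u.length / 2 ≠ n → (u ∈ A' ↔ u ∈ R)) ∧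
      (∀ w ∈ words n, BlockZero A' w ∨ BlockOne A' w) ∧ BalancedAt (decoded A') n ∧
      M.prob A' (p.eval n) true x ≠ 0
  · obtain ⟨A', h1, h2, h3, h4⟩ := hbal
    obtain ⟨h5, h6⟩ := promise A' h1 ⟨h2, Or.inr h3⟩
    refine ⟨A', h5, h6, fun h => h4 ?_⟩
    have := (h x).2 (by
      change ¬ ConstantAt _ _
      rw [hxl]
      exact not_constantAt_of_balancedAt h3)
    simpa only [hxl] using this
  · push Not at hbal
    obtain ⟨h2, h3⟩ := constantAt_flip hR
    obtain ⟨h5, h6⟩ := promise (flip R (words (2 * n))) (fun u hu => by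
      have : u ∉ words (2 * n) := fun h => hu (by have := mem_words.1 h; omega)
      simp [mem_flip, this]) ⟨fun w hw => Or.inl (h2 w hw), Or.inl h3⟩
    refine ⟨_, h5, h6, fun h => ?_⟩
    have hpos := (h x).1 (by
      change ConstantAt _ _
      rw [hxl]
      exact h3)
    simp only [hxl] at hpos
    refine hpos.ne' ((M.prob_eq_zero_iff _ _ _ _).2 fun c hc => ?_)
    refine eq_zero_of_eq_zero_on_balanced (by omega) hn
      (comp_mem_lowDegree (Finsupp.lapply c) (M.run_mem_lowDegree (p.eval n) x)) hR ?_
    intro A' h1 h2 h3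
    exact (M.prob_eq_zero_iff _ _ _ _).1 (hbal A' h1 h2 h3) c hc

theorem exists_oracle : ∃ A : Language Bool, (∀ n, PromiseAt n A) ∧ constantLanguage A ∉ NQP A := by
  have h₀ : ∀ n, PromiseAt n {u : List Bool | Even u.length} := by
    intro n
    -- The starting oracle, all words of even length, encodes 0 in every block.
    obtain ⟨h1, h2⟩ := constantAt_flip (n := n) (R := 0) fun u hu =>
      (Language.notMem_zero u hu).elim
    have hag : AgreeAt n (flip 0 (words (2 * n))) {u : List Bool | Even u.length} :=
      fun u hu => by
        have h : u ∉ (0 : Language Bool) := Language.notMem_zero u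
        change _ ↔ Even u.length
        rw [mem_flip, mem_words, Nat.even_iff]
        simp only [h, false_and, not_false_eq_true, true_and, false_or]
        omega
    exact hag.promiseAt ⟨fun w hw => Or.inl (h1 w hw), Or.inl h2⟩
  obtain ⟨A, hA, hf⟩ := exists_generic (P := PromiseAt) (fun n A A' h => h.promiseAt) h₀
    (R := Fails) (fun i A h => h.eventually) exists_fails
  exact ⟨A, hA, fun ⟨M, p, h⟩ => hf (M, p) h⟩

end

end OracleMachines

theorem theorem2 :
    ∃ A : Language Bool,
      ¬ OracleMachines.relativize OracleMachines.EQP (OracleMachines.ZPP A) ⊆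
          OracleMachines.NQP A ∧
      ¬ OracleMachines.relativize OracleMachines.ZQP (OracleMachines.ZQP A) ⊆
          OracleMachines.ZQP A := by
  obtain ⟨A, hA, hL⟩ := OracleMachines.exists_oracle
  have hblock : ∀ w, OracleMachines.BlockZero A w ∨ OracleMachines.BlockOne A w :=
    fun w => (hA w.length).1 w (OracleMachines.mem_words.2 rfl)
  have hE : OracleMachines.constantLanguage A ∈ OracleMachines.EQP (OracleMachines.decoded A) :=
    OracleMachines.constantAt_mem_EQP fun n => (hA n).2
  refine ⟨A, fun h => hL (h ?_), fun h => hL (OracleMachines.ZQP_subset_NQP A (h ?_))⟩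
  · exact Set.mem_biUnion (OracleMachines.decoded_mem_ZPP hblock) hE
  · exact Set.mem_biUnion (OracleMachines.decoded_mem_ZQP hblock)
      (OracleMachines.EQP_subset_ZQP _ hE)
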